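/- Let $SG(n)$ be the two-dimensional Sierpinski gasket graph at stage $n \ge 0$: $SG(0)$ is a triangle, and $SG(n+1)$ is obtained from three copies of $SG(n)$, each with its three outermost (corner) vertices, by arranging them as the three corner triangles of a triangle of twice the side length, so that any two copies share exactly one corner vertex (equivalently, identifying one corner of each copy with a corner of each of the other two, so that $SG(n)$ has $\frac32(3^n+1)$ vertices and $3^{n+1}$ edges; the three corners not identified are the corners of $SG(n+1)$). For a vertex $x$ of $SG(n)$ and $j \in \{1,2,3,4\}$ let \[ F_j(n,x) = \frac{\#\{T : T \text{ a spanning tree of } SG(n) \text{ in which } x \text{ has degree } j\}}{\#\{T : T \text{ a spanning tree of } SG(n)\}}, \qquad \phi_j(n) = \frac{1}{|V(SG(n))|} \sum_{x \in V(SG(n))} F_j(n,x). \] Then the limits $\phi_j = \lim_{n\to\infty} \phi_j(n)$ exist for $j = 1,2,3,4$ and are \[ \phi_1 = \frac{10957}{40464}, \qquad \phi_2 = \frac{6626035}{13636368}, \qquad \phi_3 = \frac{2943139}{13636368}, \qquad \phi_4 = \frac{124895}{4545456}. \] -/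

import Mathlib

/-- Vertices of the two-dimensional Sierpinski gasket at stage `n`. The pair `(x, y)` stands for the
point `x • u + y • v` of the plane, where `u` and `v` are two sides of a unit equilateral triangle.
Stage `0` is a triangle; stage `n + 1` consists of three translates of stage `n`, a corner triangle
of side `2 ^ n` each, any two of which share exactly one corner. -/
def sgVertices : ℕ → Finset (ℕ × ℕ)
  | 0 => {(0, 0), (1, 0), (0, 1)}
  | n + 1 =>
      sgVertices n
        ∪ (sgVertices n).image (fun p => p + (2 ^ n, 0))
        ∪ (sgVertices n).image (fun p => p + (0, 2 ^ n))

/-- Edges of the two-dimensional Sierpinski gasket at stage `n`. -/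
def sgEdges : ℕ → Finset (Sym2 (ℕ × ℕ))
  | 0 => {s((0, 0), (1, 0)), s((0, 0), (0, 1)), s((1, 0), (0, 1))}
  | n + 1 =>
      sgEdges n
        ∪ (sgEdges n).image (Sym2.map (fun p => p + (2 ^ n, 0)))
        ∪ (sgEdges n).image (Sym2.map (fun p => p + (0, 2 ^ n)))

/-- The two-dimensional Sierpinski gasket `SG(n)` as a graph on its own vertex set. -/
def SG (n : ℕ) : SimpleGraph (sgVertices n) where
  Adj x y := x ≠ y ∧ s((x : ℕ × ℕ), (y : ℕ × ℕ)) ∈ sgEdges n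
  symm := ⟨fun x y h => ⟨h.1.symm, by rw [Sym2.eq_swap]; exact h.2⟩⟩
  loopless := ⟨fun _ h => h.1 rfl⟩

/-- The set of spanning trees of a graph: the subgraphs on the same vertex set that are trees. -/
def spanningTrees {V : Type*} (G : SimpleGraph V) : Set (SimpleGraph V) :=
  {T | T ≤ G ∧ T.IsTree}

open Classical in
/-- `F_j(n, x)`: the proportion, among all spanning trees of `SG(n)`, of those in which the vertex
`x` has degree `j`. -/
noncomputable def degreeProb (j n : ℕ) (x : sgVertices n) : ℝ :=
  ({T ∈ spanningTrees (SG n) | T.degree x = j}.ncard : ℝ) / ((spanningTrees (SG n)).ncard : ℝ)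

/-- `φ_j(n)`: the average of `F_j(n, x)` over all vertices `x` of `SG(n)`. -/
noncomputable def averageDegreeProb (j n : ℕ) : ℝ :=
  (∑ x : sgVertices n, degreeProb j n x) / ((sgVertices n).card : ℝ)

/-! The gasket is glued from three copies of the previous stage at single vertices, so spanning
trees satisfy a finite recursion once trees are replaced by spanning forests every component of
which meets a corner. Such forests are sorted by the partition they induce on the three corners
(`CornerPattern`). A forest of stage `n + 1` is the same thing as a triple of forests of stage `n`
whose patterns glue without creating a cycle or a component that misses the outer corners
(`isCornerForest_glueEdges`). The admissible triples form a finite table. Weights that factor over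
the copies therefore obey the same recursion (`forestSum_succ`).

Connectivity is handled dually: two vertices are connected iff every Boolean labelling constant
along edges agrees on them. Gluing then means patching labellings, and acyclicity is read off from
edge counts.

With weight 1 the forest counts stay in the ratio `1 : r : 3 * r ^ 2`, where `r` grows by the factor
`5 / 3` (`forestCount_eq`). With weight `t ^ deg` at a corner, normalising by these counts gives a
linear recursion with constant coefficients, solved in closed form (`cornerSumsEq`). Summed over
interior vertices, the normalised generating functions satisfy a linear recursion with a 3-by-3
matrix, of eigenvalues `3`, `1` and `3 / 25`, and a source from the three junction vertices that is
quadratic in the corner means (`interiorSumsEq`). Only the eigenvalue `3` survives division by the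
number of vertices, which is about `3 / 2 * 3 ^ n`. Solving that component exactly
(`interiorMeans_leading`) gives the limiting generating function as a polynomial in `t`, and its
coefficients are the four limits. -/

/-! ### Self-similarity of vertices and edges -/

/-- The corners of `SG(n)`; they are also the translations carrying `SG(n)` to its three copies
inside `SG(n + 1)`. -/
def sgCorner (n : ℕ) : Fin 3 → ℕ × ℕ := ![(0, 0), (2 ^ n, 0), (0, 2 ^ n)]

/-- The embedding of `SG(n)` onto the `c`-th of its copies inside `SG(n + 1)`. -/
def sgShift (n : ℕ) (c : Fin 3) (p : ℕ × ℕ) : ℕ × ℕ := p + sgCorner n c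

lemma sgShift_injective (n : ℕ) (c : Fin 3) : Function.Injective (sgShift n c) :=
  add_left_injective _

lemma sgShift_map_injective (n : ℕ) (c : Fin 3) :
    Function.Injective (Sym2.map (sgShift n c)) :=
  Sym2.map.injective (sgShift_injective n c)

lemma sgShift_corner_comm (n : ℕ) (c d : Fin 3) :
    sgShift n c (sgCorner n d) = sgShift n d (sgCorner n c) := add_comm _ _

lemma sgCorner_succ (n : ℕ) (c : Fin 3) : sgCorner (n + 1) c = sgShift n c (sgCorner n c) := by
  fin_cases c <;> simp [sgCorner, sgShift, pow_succ, mul_two]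

lemma sgVertices_succ (n : ℕ) :
    sgVertices (n + 1) = Finset.univ.biUnion fun c => (sgVertices n).image (sgShift n c) := by
  ext y
  simp [sgVertices, sgShift, sgCorner, Fin.exists_fin_succ, Prod.ext_iff]

lemma sgEdges_succ (n : ℕ) :
    sgEdges (n + 1) =
      Finset.univ.biUnion fun c => (sgEdges n).image (Sym2.map (sgShift n c)) := by
  have h0 : sgShift n 0 = id := by funext p; simp [sgShift, sgCorner]
  have h1 : sgShift n 1 = fun p => p + (2 ^ n, 0) := rfl
  have h2 : sgShift n 2 = fun p => p + (0, 2 ^ n) := rfl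
  ext e
  simp [sgEdges, Fin.exists_fin_succ, h0, h1, h2]

lemma mem_sgVertices_succ {n : ℕ} {y : ℕ × ℕ} :
    y ∈ sgVertices (n + 1) ↔ ∃ c, ∃ x ∈ sgVertices n, sgShift n c x = y := by
  simp [sgVertices_succ]

lemma sgCorner_mem (n : ℕ) (i : Fin 3) : sgCorner n i ∈ sgVertices n := by
  induction n with
  | zero => fin_cases i <;> simp [sgCorner, sgVertices]
  | succ n ih => exact mem_sgVertices_succ.2 ⟨i, _, ih, (sgCorner_succ n i).symm⟩

lemma sgCorner_injective (n : ℕ) : Function.Injective (sgCorner n) := by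
  have h : (2 : ℕ) ^ n ≠ 0 := by positivity
  intro i j
  fin_cases i <;> fin_cases j <;> simp [sgCorner, h.symm]

/-- This confines each copy to its own triangle, so that overlaps of copies become a matter of
linear arithmetic. -/
lemma sgVertices_add_le {n : ℕ} {p : ℕ × ℕ} (hp : p ∈ sgVertices n) : p.1 + p.2 ≤ 2 ^ n := by
  induction n generalizing p with
  | zero =>
    simp only [sgVertices, Finset.mem_insert, Finset.mem_singleton] at hp
    rcases hp with rfl | rfl | rfl <;> simp
  | succ n ih =>
    obtain ⟨c, x, hx, rfl⟩ := mem_sgVertices_succ.1 hp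
    have := ih hx
    fin_cases c <;> simp [sgShift, sgCorner, pow_succ] <;> omega

/-- Two different copies of `SG(n)` inside `SG(n + 1)` meet in one corner of each only. -/
lemma sgShift_overlap {n : ℕ} {x y : ℕ × ℕ} (hx : x ∈ sgVertices n) (hy : y ∈ sgVertices n)
    {c d : Fin 3} (hcd : c ≠ d) (h : sgShift n c x = sgShift n d y) :
    x = sgCorner n d ∧ y = sgCorner n c := by
  have h1 := sgVertices_add_le hx
  have h2 := sgVertices_add_le hy
  obtain ⟨x1, x2⟩ := x
  obtain ⟨y1, y2⟩ := y
  fin_cases c <;> fin_cases d <;> simp [sgShift, sgCorner, Prod.ext_iff] at * <;> omega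

lemma sgEdges_mem_vertices {n : ℕ} {e : Sym2 (ℕ × ℕ)} (he : e ∈ sgEdges n) :
    ¬ e.IsDiag ∧ ∀ x ∈ e, x ∈ sgVertices n := by
  induction n generalizing e with
  | zero =>
    simp only [sgEdges, Finset.mem_insert, Finset.mem_singleton] at he
    rcases he with rfl | rfl | rfl <;> simp [sgVertices]
  | succ n ih =>
    simp only [sgEdges_succ, Finset.mem_biUnion, Finset.mem_univ, true_and,
      Finset.mem_image] at he
    obtain ⟨c, e, he, rfl⟩ := he
    obtain ⟨h1, h2⟩ := ih he
    refine ⟨?_, fun x hx => ?_⟩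
    · rwa [Sym2.isDiag_map (sgShift_injective n c)]
    · obtain ⟨y, hy, rfl⟩ := Sym2.mem_map.1 hx
      exact mem_sgVertices_succ.2 ⟨c, y, h2 y hy, rfl⟩

/-- Two different copies of `SG(n)` inside `SG(n + 1)` have no common edge. -/
lemma sgShift_map_eq {n : ℕ} {c d : Fin 3} {e e' : Sym2 (ℕ × ℕ)} (he : e ∈ sgEdges n)
    (he' : e' ∈ sgEdges n) (h : Sym2.map (sgShift n c) e = Sym2.map (sgShift n d) e') :
    c = d := by
  by_contra hcd
  obtain ⟨h1, h2⟩ := sgEdges_mem_vertices he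
  obtain ⟨-, h3⟩ := sgEdges_mem_vertices he'
  -- Both ends of a common edge would be the one vertex shared by the copies, making the edge a
  -- loop.
  have key : ∀ x ∈ e, x = sgCorner n d := by
    intro x hx
    have : sgShift n c x ∈ Sym2.map (sgShift n d) e' := h ▸ Sym2.mem_map.2 ⟨x, hx, rfl⟩
    obtain ⟨y, hy, hxy⟩ := Sym2.mem_map.1 this
    exact (sgShift_overlap (h2 x hx) (h3 y hy) hcd hxy.symm).1
  induction e using Sym2.ind with
  | _ a b => exact h1 (by simp [key a (by simp), key b (by simp)])

/-! ### Cutting and gluing edge sets -/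

/-- The union of edge sets of the three copies of `SG(n)` inside `SG(n + 1)`. -/
def glueEdges (n : ℕ) (S : Fin 3 → Finset (Sym2 (ℕ × ℕ))) : Finset (Sym2 (ℕ × ℕ)) :=
  Finset.univ.biUnion fun c => (S c).image (Sym2.map (sgShift n c))

/-- The part of an edge set of `SG(n + 1)` lying in the `c`-th copy of `SG(n)`. -/
def cutEdges (n : ℕ) (S : Finset (Sym2 (ℕ × ℕ))) (c : Fin 3) : Finset (Sym2 (ℕ × ℕ)) :=
  (sgEdges n).filter fun e => Sym2.map (sgShift n c) e ∈ S

lemma mem_glueEdges {n : ℕ} {S : Fin 3 → Finset (Sym2 (ℕ × ℕ))} {e : Sym2 (ℕ × ℕ)} :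
    e ∈ glueEdges n S ↔ ∃ c, ∃ e' ∈ S c, Sym2.map (sgShift n c) e' = e := by
  simp [glueEdges]

lemma glueEdges_subset {n : ℕ} {S : Fin 3 → Finset (Sym2 (ℕ × ℕ))}
    (hS : ∀ c, S c ⊆ sgEdges n) : glueEdges n S ⊆ sgEdges (n + 1) := by
  rw [sgEdges_succ]
  exact Finset.biUnion_mono fun c _ => Finset.image_subset_image (hS c)

lemma cutEdges_subset (n : ℕ) (S : Finset (Sym2 (ℕ × ℕ))) (c : Fin 3) :
    cutEdges n S c ⊆ sgEdges n := Finset.filter_subset _ _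

lemma glueEdges_cutEdges {n : ℕ} {S : Finset (Sym2 (ℕ × ℕ))} (hS : S ⊆ sgEdges (n + 1)) :
    glueEdges n (cutEdges n S) = S := by
  ext e
  simp only [mem_glueEdges, cutEdges, Finset.mem_filter]
  constructor
  · rintro ⟨c, e', ⟨-, h⟩, rfl⟩
    exact h
  · intro he
    have := hS he
    simp only [sgEdges_succ, Finset.mem_biUnion, Finset.mem_univ, true_and,
      Finset.mem_image] at this
    obtain ⟨c, e', he', rfl⟩ := this
    exact ⟨c, e', ⟨he', he⟩, rfl⟩

lemma cutEdges_glueEdges {n : ℕ} {S : Fin 3 → Finset (Sym2 (ℕ × ℕ))}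
    (hS : ∀ c, S c ⊆ sgEdges n) : cutEdges n (glueEdges n S) = S := by
  funext c
  ext e
  simp only [mem_glueEdges, cutEdges, Finset.mem_filter]
  constructor
  · rintro ⟨he, d, e', he', h⟩
    obtain rfl := sgShift_map_eq (hS d he') he h
    rwa [← sgShift_map_injective n d h]
  · exact fun he => ⟨hS c he, c, e, he, rfl⟩

lemma sum_glueEdges {M : Type*} [AddCommMonoid M] {n : ℕ} {S : Fin 3 → Finset (Sym2 (ℕ × ℕ))}
    (hS : ∀ c, S c ⊆ sgEdges n) (w : Sym2 (ℕ × ℕ) → M) :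
    ∑ e ∈ glueEdges n S, w e = ∑ c, ∑ e ∈ S c, w (Sym2.map (sgShift n c) e) := by
  rw [glueEdges, Finset.sum_biUnion]
  · exact Finset.sum_congr rfl fun c _ =>
      Finset.sum_image fun _ _ _ _ h => sgShift_map_injective n c h
  · intro c _ d _ hcd
    refine Finset.disjoint_left.2 fun e he he' => hcd ?_
    obtain ⟨a, ha, rfl⟩ := Finset.mem_image.1 he
    obtain ⟨b, hb, h⟩ := Finset.mem_image.1 he'
    exact (sgShift_map_eq (hS d hb) (hS c ha) h).symm

lemma card_glueEdges {n : ℕ} {S : Fin 3 → Finset (Sym2 (ℕ × ℕ))}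
    (hS : ∀ c, S c ⊆ sgEdges n) : (glueEdges n S).card = ∑ c, (S c).card := by
  simpa only [Finset.card_eq_sum_ones] using sum_glueEdges hS fun _ => 1

/-! ### Interior vertices -/

/-- The vertices of `SG(n)` that are not corners. -/
def sgInterior (n : ℕ) : Finset (ℕ × ℕ) := sgVertices n \ Finset.univ.image (sgCorner n)

lemma mem_sgInterior {n : ℕ} {x : ℕ × ℕ} :
    x ∈ sgInterior n ↔ x ∈ sgVertices n ∧ ∀ i, x ≠ sgCorner n i := by
  simp [sgInterior, eq_comm]

lemma sum_sgVertices {M : Type*} [AddCommMonoid M] (n : ℕ) (w : ℕ × ℕ → M) :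
    ∑ x ∈ sgVertices n, w x = ∑ x ∈ sgInterior n, w x + ∑ i, w (sgCorner n i) := by
  have h : Finset.univ.image (sgCorner n) ⊆ sgVertices n := by
    intro x hx
    obtain ⟨i, -, rfl⟩ := Finset.mem_image.1 hx
    exact sgCorner_mem n i
  rw [← Finset.sum_sdiff h, ← Finset.sum_image fun _ _ _ _ h => sgCorner_injective n h]
  rfl

lemma sgInterior_zero : sgInterior 0 = ∅ := by decide

/-- The interior of `SG(n + 1)` consists of the interiors of its three copies of `SG(n)` and of
the three vertices joining two copies; the latter are indexed by the copy they do not lie in. -/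
lemma sum_sgInterior_succ {M : Type*} [AddCommMonoid M] (n : ℕ) (w : ℕ × ℕ → M) :
    ∑ x ∈ sgInterior (n + 1), w x =
      ∑ c, ∑ x ∈ sgInterior n, w (sgShift n c x) +
        ∑ c : Fin 3, w (sgShift n (c + 1) (sgCorner n (c + 2))) := by
  have hsplit : sgInterior (n + 1) =
      (Finset.univ.biUnion fun c => (sgInterior n).image (sgShift n c)) ∪
        Finset.univ.image fun c : Fin 3 => sgShift n (c + 1) (sgCorner n (c + 2)) := by
    ext y
    simp only [mem_sgInterior, Finset.mem_union, Finset.mem_biUnion, Finset.mem_image,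
      Finset.mem_univ, true_and]
    constructor
    · rintro ⟨hy, hc⟩
      obtain ⟨c, x, hx, rfl⟩ := mem_sgVertices_succ.1 hy
      by_cases h : ∃ i, x = sgCorner n i
      · obtain ⟨i, rfl⟩ := h
        right
        have hic : i ≠ c := by
          rintro rfl
          exact hc i (sgCorner_succ n i).symm
        -- Two distinct copies are the two other than some `a`, in one order or the other.
        have : (∃ a : Fin 3, c = a + 1 ∧ i = a + 2) ∨ ∃ a : Fin 3, i = a + 1 ∧ c = a + 2 := by
          clear hc hy hx
          revert i c; decide
        obtain ⟨a, rfl, rfl⟩ | ⟨a, rfl, rfl⟩ := this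
        · exact ⟨a, rfl⟩
        · exact ⟨a, sgShift_corner_comm ..⟩
      · push Not at h
        exact Or.inl ⟨c, x, ⟨hx, h⟩, rfl⟩
    · rintro (⟨c, x, ⟨hx, h⟩, rfl⟩ | ⟨a, rfl⟩)
      · refine ⟨mem_sgVertices_succ.2 ⟨c, x, hx, rfl⟩, fun i hi => ?_⟩
        rw [sgCorner_succ] at hi
        by_cases hci : c = i
        · subst hci
          exact h c (sgShift_injective n c hi)
        · exact h i (sgShift_overlap hx (sgCorner_mem n i) hci hi).1
      · refine ⟨mem_sgVertices_succ.2 ⟨_, _, sgCorner_mem n _, rfl⟩, fun i hi => ?_⟩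
        rw [sgCorner_succ] at hi
        by_cases hci : a + 1 = i
        · subst hci
          exact (by decide : ∀ a : Fin 3, a + 2 ≠ a + 1) a
            (sgCorner_injective n (sgShift_injective n _ hi))
        · have h' := sgShift_overlap (sgCorner_mem n _) (sgCorner_mem n i) hci hi
          exact hci (sgCorner_injective n h'.2).symm
  have hinj : Function.Injective fun c : Fin 3 => sgShift n (c + 1) (sgCorner n (c + 2)) := by
    intro a b hab
    by_contra hne
    have := sgShift_overlap (sgCorner_mem n _) (sgCorner_mem n _)
      (fun h => hne (add_right_cancel h)) hab
    exact (by decide : ∀ a b : Fin 3, a + 2 = b + 1 → b + 2 = a + 1 → False) a b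
      (sgCorner_injective n this.1) (sgCorner_injective n this.2)
  rw [hsplit, Finset.sum_union, Finset.sum_biUnion, Finset.sum_image fun _ _ _ _ h => hinj h]
  · congr 1
    exact Finset.sum_congr rfl fun c _ =>
      Finset.sum_image fun _ _ _ _ h => sgShift_injective n c h
  · intro c _ d _ hcd
    refine Finset.disjoint_left.2 fun y hy hy' => ?_
    obtain ⟨a, ha, rfl⟩ := Finset.mem_image.1 hy
    obtain ⟨b, hb, h⟩ := Finset.mem_image.1 hy'
    rw [mem_sgInterior] at ha hb
    exact ha.2 _ (sgShift_overlap ha.1 hb.1 hcd h.symm).1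
  · refine Finset.disjoint_left.2 fun y hy hy' => ?_
    obtain ⟨c, -, hy⟩ := Finset.mem_biUnion.1 hy
    obtain ⟨a, ha, rfl⟩ := Finset.mem_image.1 hy
    obtain ⟨b, -, h⟩ := Finset.mem_image.1 hy'
    rw [mem_sgInterior] at ha
    by_cases hcb : b + 1 = c
    · subst hcb
      exact ha.2 _ (sgShift_injective n _ h).symm
    · exact ha.2 _ (sgShift_overlap (sgCorner_mem n _) ha.1 hcb h).2

lemma card_sgInterior_add (n : ℕ) : (sgInterior n).card + 3 = (sgVertices n).card := by
  have := sum_sgVertices n fun _ => 1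
  simp at this
  omega

lemma card_sgVertices_succ (n : ℕ) : (sgVertices (n + 1)).card + 3 = 3 * (sgVertices n).card := by
  have h := sum_sgInterior_succ n fun _ => 1
  simp at h
  have h1 := card_sgInterior_add n
  have h2 := card_sgInterior_add (n + 1)
  omega

lemma two_mul_card_sgVertices (n : ℕ) : 2 * (sgVertices n).card = 3 * (3 ^ n + 1) := by
  induction n with
  | zero => rfl
  | succ n ih =>
    have := card_sgVertices_succ n
    rw [pow_succ]
    omega

/-! ### Partitions of the three corners -/

/-- The partitions of a set of three corners. -/
inductive CornerPattern
  /-- all three corners in one block -/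
  | joined
  /-- one corner apart from the two others -/
  | isolated (i : Fin 3)
  /-- three singletons -/
  | separated
  deriving DecidableEq, Fintype

namespace CornerPattern

/-- Two corners lie in the same block. -/
def rel : CornerPattern → Fin 3 → Fin 3 → Bool
  | joined, _, _ => true
  | isolated k, i, j => i == j || (i != k && j != k)
  | separated, i, j => i == j

/-- The number of blocks. -/
def blocks : CornerPattern → ℕ
  | joined => 1
  | isolated _ => 2
  | separated => 3

/-- A labelling of the corners is constant on blocks. -/
def Respects (π : CornerPattern) (b : Fin 3 → Bool) : Prop := ∀ i j, π.rel i j = true → b i = b j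

lemma rel_refl : ∀ (π : CornerPattern) (i : Fin 3), π.rel i i = true := by decide

lemma rel_symm : ∀ (π : CornerPattern) (i j : Fin 3), π.rel i j = true → π.rel j i = true := by
  decide

lemma exists_rel_iff {R : Fin 3 → Fin 3 → Prop} (hR : Equivalence R) :
    ∃ π : CornerPattern, ∀ i j, π.rel i j = true ↔ R i j := by
  have hs : ∀ i j, R i j ↔ R j i := fun i j => ⟨hR.symm, hR.symm⟩
  have hr : ∀ i, R i i := hR.refl
  have h1 := hs 1 0
  have h2 := hs 2 0
  have h3 := hs 2 1
  have t1 := @hR.trans 0 1 2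
  have t2 := @hR.trans 0 2 1
  have t3 := @hR.trans 1 0 2
  by_cases h01 : R 0 1 <;> by_cases h02 : R 0 2 <;> by_cases h12 : R 1 2
  all_goals first
    | tauto
    | (refine ⟨joined, ?_⟩; simp [Fin.forall_fin_succ, rel, *]; done)
    | (refine ⟨isolated 0, ?_⟩; simp [Fin.forall_fin_succ, rel, *]; done)
    | (refine ⟨isolated 1, ?_⟩; simp [Fin.forall_fin_succ, rel, *]; done)
    | (refine ⟨isolated 2, ?_⟩; simp [Fin.forall_fin_succ, rel, *]; done)
    | (refine ⟨separated, ?_⟩; simp [Fin.forall_fin_succ, rel, *])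

/-- One corner per block suffices to pin down a labelling on all corners; this supplies the extra
coordinates in `card_le_of_reachesCorners`. -/
lemma exists_representatives (π : CornerPattern) :
    ∃ ρ : Fin π.blocks → Fin 3, ∀ i, ∃ k, π.rel i (ρ k) = true := by
  cases π with
  | joined => exact ⟨fun _ => 0, fun _ => ⟨(0 : Fin 1), rfl⟩⟩
  | isolated i =>
    refine ⟨(![i, i + 1] : Fin 2 → Fin 3), fun j => ?_⟩
    revert i j
    decide
  | separated => exact ⟨(id : Fin 3 → Fin 3), fun j => ⟨j, by simp [rel]⟩⟩

/-! ### Gluing three corner patterns -/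

/-- The symmetric labelling of pairs of indices with the given six values. The pair `c, d` stands
for the common corner of the copies `c` and `d`, the pair `c, c` for the outer corner of the copy
`c`. -/
def symmLabel (a₀ a₁ a₂ b₀ b₁ b₂ : Bool) : Fin 3 → Fin 3 → Bool
  | 0, 0 => a₀
  | 1, 1 => a₁
  | 2, 2 => a₂
  | 1, 2 | 2, 1 => b₀
  | 0, 2 | 2, 0 => b₁
  | 0, 1 | 1, 0 => b₂

lemma symmLabel_comm : ∀ (a₀ a₁ a₂ b₀ b₁ b₂ : Bool) (c d : Fin 3),
    symmLabel a₀ a₁ a₂ b₀ b₁ b₂ c d = symmLabel a₀ a₁ a₂ b₀ b₁ b₂ d c := by decide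

lemma eq_symmLabel {m : Fin 3 → Fin 3 → Bool} (hm : ∀ c d, m c d = m d c) :
    m = symmLabel (m 0 0) (m 1 1) (m 2 2) (m 1 2) (m 0 2) (m 0 1) := by
  funext c d
  fin_cases c <;> fin_cases d <;> simp [symmLabel, hm 1 0, hm 2 0, hm 2 1]

/-- The labelling `m` of the six corners of three copies is constant on the blocks of the
pattern of each copy. -/
def Compatible (π : Fin 3 → CornerPattern) (m : Fin 3 → Fin 3 → Bool) : Prop :=
  (∀ c d, m c d = m d c) ∧ ∀ c, (π c).Respects (m c)

/-- Gluing three copies with the given patterns, every component contains an outer corner. -/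
def Spans (π : Fin 3 → CornerPattern) : Prop :=
  ∀ m, Compatible π m → (∀ c, m c c = false) → ∀ c d, m c d = false

/-- Gluing three copies with patterns `π` induces the pattern `π'` on the outer corners. -/
def Induces (π : Fin 3 → CornerPattern) (π' : CornerPattern) : Prop :=
  ∀ i j, π'.rel i j = true ↔ ∀ m, Compatible π m → m i i = m j j

/-- Forests with patterns `π` glue to a forest with pattern `π'`. -/
def GluesTo (π : Fin 3 → CornerPattern) (π' : CornerPattern) : Prop :=
  Spans π ∧ Induces π π' ∧ ∑ c, (π c).blocks = 3 + π'.blocks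

/-- The pattern to which forests with the given patterns glue. -/
def glue : CornerPattern → CornerPattern → CornerPattern → Option CornerPattern
  | joined, joined, isolated 0 => some joined
  | joined, joined, isolated 1 => some joined
  | joined, isolated 0, joined => some joined
  | joined, isolated 2, joined => some joined
  | isolated 1, joined, joined => some joined
  | isolated 2, joined, joined => some joined
  | joined, isolated 0, isolated 0 => some (isolated 0)
  | isolated 0, joined, isolated 0 => some (isolated 0)
  | isolated 0, joined, isolated 1 => some (isolated 0)
  | isolated 0, isolated 0, joined => some (isolated 0)
  | isolated 0, isolated 2, joined => some (isolated 0)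
  | isolated 1, joined, isolated 0 => some (isolated 0)
  | isolated 2, isolated 0, joined => some (isolated 0)
  | separated, joined, joined => some (isolated 0)
  | joined, isolated 0, isolated 1 => some (isolated 1)
  | joined, isolated 1, isolated 0 => some (isolated 1)
  | joined, isolated 1, isolated 1 => some (isolated 1)
  | joined, separated, joined => some (isolated 1)
  | isolated 1, joined, isolated 1 => some (isolated 1)
  | isolated 1, isolated 1, joined => some (isolated 1)
  | isolated 1, isolated 2, joined => some (isolated 1)
  | isolated 2, isolated 1, joined => some (isolated 1)
  | joined, joined, separated => some (isolated 2)
  | joined, isolated 0, isolated 2 => some (isolated 2)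
  | joined, isolated 2, isolated 0 => some (isolated 2)
  | joined, isolated 2, isolated 2 => some (isolated 2)
  | isolated 1, joined, isolated 2 => some (isolated 2)
  | isolated 2, joined, isolated 1 => some (isolated 2)
  | isolated 2, joined, isolated 2 => some (isolated 2)
  | isolated 2, isolated 2, joined => some (isolated 2)
  | joined, isolated 0, separated => some separated
  | joined, isolated 1, separated => some separated
  | joined, separated, isolated 0 => some separated
  | joined, separated, isolated 2 => some separated
  | isolated 0, joined, separated => some separated
  | isolated 0, isolated 0, isolated 1 => some separated
  | isolated 0, isolated 0, isolated 2 => some separated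
  | isolated 0, isolated 1, isolated 0 => some separated
  | isolated 0, isolated 1, isolated 1 => some separated
  | isolated 0, isolated 2, isolated 0 => some separated
  | isolated 0, isolated 2, isolated 2 => some separated
  | isolated 0, separated, joined => some separated
  | isolated 1, joined, separated => some separated
  | isolated 1, isolated 1, isolated 0 => some separated
  | isolated 1, isolated 1, isolated 2 => some separated
  | isolated 1, isolated 2, isolated 0 => some separated
  | isolated 1, isolated 2, isolated 2 => some separated
  | isolated 2, isolated 0, isolated 1 => some separated
  | isolated 2, isolated 0, isolated 2 => some separated
  | isolated 2, isolated 1, isolated 1 => some separated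
  | isolated 2, isolated 1, isolated 2 => some separated
  | isolated 2, separated, joined => some separated
  | separated, joined, isolated 1 => some separated
  | separated, joined, isolated 2 => some separated
  | separated, isolated 1, joined => some separated
  | separated, isolated 2, joined => some separated
  | _, _, _ => none

/-- `Respects` for a labelling given by its values. -/
def respectsValues : CornerPattern → Bool → Bool → Bool → Bool
  | joined, x, y, z => x == y && y == z
  | isolated 0, _, y, z => y == z
  | isolated 1, x, _, z => x == z
  | isolated 2, x, y, _ => x == y
  | separated, _, _, _ => true

/-- `Compatible` for a labelling given by its values. -/
def compatibleValues (p₀ p₁ p₂ : CornerPattern) (a₀ a₁ a₂ b₀ b₁ b₂ : Bool) : Bool :=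
  p₀.respectsValues a₀ b₂ b₁ && p₁.respectsValues b₂ a₁ b₀ && p₂.respectsValues b₁ b₀ a₂

lemma respects_iff : ∀ (π : CornerPattern) (x y z : Bool),
    (∀ i j, π.rel i j = true → (![x, y, z] : Fin 3 → Bool) i = (![x, y, z] : Fin 3 → Bool) j) ↔
      π.respectsValues x y z = true := by
  decide

lemma compatible_iff {π : Fin 3 → CornerPattern} {m : Fin 3 → Fin 3 → Bool}
    (hm : ∀ c d, m c d = m d c) :
    Compatible π m ↔ compatibleValues (π 0) (π 1) (π 2)
      (m 0 0) (m 1 1) (m 2 2) (m 1 2) (m 0 2) (m 0 1) = true := by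
  have key : ∀ (c : Fin 3), (π c).Respects (m c) ↔
      (π c).respectsValues (m c 0) (m c 1) (m c 2) = true := by
    intro c
    rw [← respects_iff, Respects]
    have : m c = ![m c 0, m c 1, m c 2] := by
      funext i
      fin_cases i <;> rfl
    rw [← this]
  simp only [Compatible, key, Fin.forall_fin_succ, compatibleValues]
  simp [hm 1 0, hm 2 0, hm 2 1, and_assoc]

/-- A symmetric labelling has only six free values, so quantifying over functions reduces to
quantifying over six Booleans, which the kernel can enumerate. -/
lemma forall_compatible {π : Fin 3 → CornerPattern} {P : (Fin 3 → Fin 3 → Bool) → Prop} :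
    (∀ m, Compatible π m → P m) ↔ ∀ a₀ a₁ a₂ b₀ b₁ b₂,
      compatibleValues (π 0) (π 1) (π 2) a₀ a₁ a₂ b₀ b₁ b₂ = true →
        P (symmLabel a₀ a₁ a₂ b₀ b₁ b₂) := by
  constructor
  · intro h a₀ a₁ a₂ b₀ b₁ b₂ hc
    exact h _ ((compatible_iff (symmLabel_comm _ _ _ _ _ _)).2 hc)
  · intro h m hm
    rw [eq_symmLabel hm.1]
    exact h _ _ _ _ _ _ ((compatible_iff hm.1).1 hm)

/-- `Spans` in terms of values. -/
def SpansValues (p₀ p₁ p₂ : CornerPattern) : Prop :=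
  ∀ b₀ b₁ b₂, compatibleValues p₀ p₁ p₂ false false false b₀ b₁ b₂ = true →
    b₀ = false ∧ b₁ = false ∧ b₂ = false

/-- `Induces` in terms of values. -/
def InducesValues (p₀ p₁ p₂ q : CornerPattern) : Prop :=
  (q.rel 0 1 = true ↔ ∀ a₀ a₁ a₂ b₀ b₁ b₂,
    compatibleValues p₀ p₁ p₂ a₀ a₁ a₂ b₀ b₁ b₂ = true → a₀ = a₁) ∧
  (q.rel 0 2 = true ↔ ∀ a₀ a₁ a₂ b₀ b₁ b₂,
    compatibleValues p₀ p₁ p₂ a₀ a₁ a₂ b₀ b₁ b₂ = true → a₀ = a₂) ∧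
  (q.rel 1 2 = true ↔ ∀ a₀ a₁ a₂ b₀ b₁ b₂,
    compatibleValues p₀ p₁ p₂ a₀ a₁ a₂ b₀ b₁ b₂ = true → a₁ = a₂)

instance (p₀ p₁ p₂ : CornerPattern) : Decidable (SpansValues p₀ p₁ p₂) := by
  unfold SpansValues; infer_instance

instance (p₀ p₁ p₂ q : CornerPattern) : Decidable (InducesValues p₀ p₁ p₂ q) := by
  unfold InducesValues; infer_instance

lemma spans_iff (π : Fin 3 → CornerPattern) : Spans π ↔ SpansValues (π 0) (π 1) (π 2) := by
  rw [Spans, forall_compatible, SpansValues]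
  constructor
  · intro h b₀ b₁ b₂ hb
    have := h _ _ _ _ _ _ hb (by simp [Fin.forall_fin_succ, symmLabel])
    exact ⟨this 1 2, this 0 2, this 0 1⟩
  · intro h a₀ a₁ a₂ b₀ b₁ b₂ hc h0
    obtain rfl : a₀ = false := h0 0
    obtain rfl : a₁ = false := h0 1
    obtain rfl : a₂ = false := h0 2
    obtain ⟨rfl, rfl, rfl⟩ := h b₀ b₁ b₂ hc
    decide

lemma induces_iff (π : Fin 3 → CornerPattern) (q : CornerPattern) :
    Induces π q ↔ InducesValues (π 0) (π 1) (π 2) q := by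
  have hs : ∀ i j, q.rel i j = true ↔ q.rel j i = true := fun i j => ⟨rel_symm q i j, rel_symm q j i⟩
  have e : ∀ i j : Fin 3, (∀ m, Compatible π m → m i i = m j j) ↔
      ∀ m, Compatible π m → m j j = m i i := fun i j => by simp only [eq_comm]
  simp only [Induces, InducesValues]
  constructor
  · intro h
    have h01 := h 0 1
    have h02 := h 0 2
    have h12 := h 1 2
    rw [forall_compatible] at h01 h02 h12
    exact ⟨h01, h02, h12⟩
  · rintro ⟨h01, h02, h12⟩
    have h01' : q.rel 0 1 = true ↔ ∀ m, Compatible π m → m 0 0 = m 1 1 := by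
      rw [forall_compatible]; exact h01
    have h02' : q.rel 0 2 = true ↔ ∀ m, Compatible π m → m 0 0 = m 2 2 := by
      rw [forall_compatible]; exact h02
    have h12' : q.rel 1 2 = true ↔ ∀ m, Compatible π m → m 1 1 = m 2 2 := by
      rw [forall_compatible]; exact h12
    intro i j
    fin_cases i <;> fin_cases j <;> simp only [Fin.zero_eta, Fin.mk_one, Fin.reduceFinMk]
    · simp [rel_refl]
    · exact h01'
    · exact h02'
    · rw [hs, e]; exact h01'
    · simp [rel_refl]
    · exact h12'
    · rw [hs, e]; exact h02'
    · rw [hs, e]; exact h12'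
    · simp [rel_refl]

/-- Each of the three identifications of corners lowers the number of components by at most one,
which explains the inequality; equality means that no identification closes a cycle. The proof is an
exhaustive check. -/
lemma glue_values : ∀ p₀ p₁ p₂ : CornerPattern, SpansValues p₀ p₁ p₂ →
    ∀ q, InducesValues p₀ p₁ p₂ q → p₀.blocks + p₁.blocks + p₂.blocks ≤ 3 + q.blocks ∧
      (p₀.blocks + p₁.blocks + p₂.blocks = 3 + q.blocks → glue p₀ p₁ p₂ = some q) := by
  decide +kernel

lemma glue_eq_some : ∀ p₀ p₁ p₂ q : CornerPattern, glue p₀ p₁ p₂ = some q →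
    SpansValues p₀ p₁ p₂ ∧ InducesValues p₀ p₁ p₂ q ∧
      p₀.blocks + p₁.blocks + p₂.blocks = 3 + q.blocks := by
  decide +kernel

lemma gluesTo_iff (π : Fin 3 → CornerPattern) (q : CornerPattern) :
    GluesTo π q ↔ glue (π 0) (π 1) (π 2) = some q := by
  rw [GluesTo, spans_iff, induces_iff, Fin.sum_univ_three]
  exact ⟨fun h => (glue_values _ _ _ h.1 _ h.2.1).2 h.2.2, glue_eq_some _ _ _ _⟩

lemma sum_blocks_le {π : Fin 3 → CornerPattern} {q : CornerPattern} (h : Spans π)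
    (h' : Induces π q) : ∑ c, (π c).blocks ≤ 3 + q.blocks := by
  rw [Fin.sum_univ_three]
  exact (glue_values _ _ _ ((spans_iff π).1 h) _ ((induces_iff π q).1 h')).1

end CornerPattern

/-! ### Spanning forests and the patterns they induce on the corners -/

/-- The labelling `φ` takes the same value on the two ends of every edge in `S`. -/
def EdgeInvariant {V : Type*} (S : Finset (Sym2 V)) (φ : V → Bool) : Prop :=
  ∀ x y, s(x, y) ∈ S → φ x = φ y

/-- Every component of the graph on `sgVertices n` with edges `S` contains a corner. -/
def ReachesCorners (n : ℕ) (S : Finset (Sym2 (ℕ × ℕ))) : Prop :=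
  ∀ φ, EdgeInvariant S φ → (∀ i, φ (sgCorner n i) = false) → ∀ x ∈ sgVertices n, φ x = false

/-- The connectivity relation of the edges `S` on the corners is given by the pattern `π`. -/
def HasPattern (n : ℕ) (π : CornerPattern) (S : Finset (Sym2 (ℕ × ℕ))) : Prop :=
  ∀ i j, π.rel i j = true ↔ ∀ φ, EdgeInvariant S φ → φ (sgCorner n i) = φ (sgCorner n j)

/-- The edges `S` form a spanning forest of `SG(n)` each of whose components contains a corner,
with the corners distributed to the components as in `π`. -/
def IsCornerForest (n : ℕ) (π : CornerPattern) (S : Finset (Sym2 (ℕ × ℕ))) : Prop :=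
  ReachesCorners n S ∧ HasPattern n π S ∧ S.card + π.blocks = (sgVertices n).card

lemma exists_hasPattern (n : ℕ) (S : Finset (Sym2 (ℕ × ℕ))) : ∃ π, HasPattern n π S :=
  CornerPattern.exists_rel_iff
    ⟨fun _ _ _ => rfl, fun h φ hφ => (h φ hφ).symm, fun h h' φ hφ => (h φ hφ).trans (h' φ hφ)⟩

lemma HasPattern.unique {n : ℕ} {π π' : CornerPattern} {S : Finset (Sym2 (ℕ × ℕ))}
    (h : HasPattern n π S) (h' : HasPattern n π' S) : π = π' := by
  have key : ∀ i j, π.rel i j = π'.rel i j := fun i j =>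
    Bool.eq_iff_iff.2 ((h i j).trans (h' i j).symm)
  clear h h'
  revert π π'
  decide

lemma HasPattern.respects {n : ℕ} {π : CornerPattern} {S : Finset (Sym2 (ℕ × ℕ))}
    (h : HasPattern n π S) {φ : ℕ × ℕ → Bool} (hφ : EdgeInvariant S φ) :
    π.Respects fun i => φ (sgCorner n i) := fun i j hij => (h i j).1 hij φ hφ

open Classical in
/-- A labelling of the corners respecting the pattern of `S` extends to an invariant one. -/
lemma HasPattern.exists_extension {n : ℕ} {π : CornerPattern} {S : Finset (Sym2 (ℕ × ℕ))}
    (h : HasPattern n π S) {b : Fin 3 → Bool} (hb : π.Respects b) :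
    ∃ φ, EdgeInvariant S φ ∧ ∀ i, φ (sgCorner n i) = b i := by
  -- The indicator of the union of the components of corners labelled `true`; `hb` keeps it off the
  -- corners labelled `false`.
  refine ⟨fun x => decide (∃ i, b i = true ∧
    ∀ ψ, EdgeInvariant S ψ → ψ (sgCorner n i) = ψ x), ?_, ?_⟩
  · intro x y hxy
    refine decide_eq_decide.2 (exists_congr fun i => and_congr_right fun _ =>
      forall₂_congr fun ψ hψ => ?_)
    rw [hψ x y hxy]
  · intro j
    rw [Bool.eq_iff_iff, decide_eq_true_iff]
    constructor
    · rintro ⟨i, hi, hij⟩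
      rw [← hb i j ((h i j).2 hij), hi]
    · exact fun hj => ⟨j, hj, fun _ _ => rfl⟩

lemma edgeInvariant_glueEdges {n : ℕ} {S : Fin 3 → Finset (Sym2 (ℕ × ℕ))}
    {φ : ℕ × ℕ → Bool} :
    EdgeInvariant (glueEdges n S) φ ↔ ∀ c, EdgeInvariant (S c) (φ ∘ sgShift n c) := by
  constructor
  · exact fun h c x y hxy => h _ _ (mem_glueEdges.2 ⟨c, _, hxy, rfl⟩)
  · intro h x y hxy
    obtain ⟨c, e, he, hxy⟩ := mem_glueEdges.1 hxy
    induction e using Sym2.ind with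
    | _ a b =>
      have := h c a b he
      simp only [Sym2.map_mk, Sym2.eq_iff] at hxy
      rcases hxy with ⟨rfl, rfl⟩ | ⟨rfl, rfl⟩
      · exact this
      · exact this.symm

open Classical in
/-- Labellings of the three copies agreeing on common corners glue. -/
lemma exists_glued_labelling {n : ℕ} (ψ : Fin 3 → ℕ × ℕ → Bool)
    (hψ : ∀ c d, ψ c (sgCorner n d) = ψ d (sgCorner n c)) :
    ∃ φ : ℕ × ℕ → Bool, ∀ c, ∀ x ∈ sgVertices n, φ (sgShift n c x) = ψ c x := by
  refine ⟨fun y => decide (∃ c, ∃ x ∈ sgVertices n, sgShift n c x = y ∧ ψ c x = true), ?_⟩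
  intro c x hx
  rw [Bool.eq_iff_iff, decide_eq_true_iff]
  constructor
  · rintro ⟨d, y, hy, hxy, h⟩
    by_cases hdc : d = c
    · subst hdc
      rwa [← sgShift_injective n d hxy]
    · obtain ⟨rfl, rfl⟩ := sgShift_overlap hy hx hdc hxy
      rwa [hψ]
  · exact fun h => ⟨c, x, hx, rfl, h⟩

/-- Labellings are defined on all of `ℕ × ℕ`, while a glued labelling is controlled only on
vertices; edges see nothing else. -/
lemma EdgeInvariant.congr {n : ℕ} {S : Finset (Sym2 (ℕ × ℕ))} (hS : S ⊆ sgEdges n)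
    {φ ψ : ℕ × ℕ → Bool} (h : ∀ x ∈ sgVertices n, φ x = ψ x) (hψ : EdgeInvariant S ψ) :
    EdgeInvariant S φ := by
  intro x y hxy
  have hv := (sgEdges_mem_vertices (hS hxy)).2
  rw [h x (hv x (by simp)), h y (hv y (by simp))]
  exact hψ x y hxy

/-! ### Connectivity of glued edge sets -/

section Gluing

variable {n : ℕ} {S : Fin 3 → Finset (Sym2 (ℕ × ℕ))} {π : Fin 3 → CornerPattern}

lemma exists_invariant_of_glued (hS : ∀ c, S c ⊆ sgEdges n) (ψ : Fin 3 → ℕ × ℕ → Bool)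
    (hψ : ∀ c d, ψ c (sgCorner n d) = ψ d (sgCorner n c))
    (hinv : ∀ c, EdgeInvariant (S c) (ψ c)) :
    ∃ φ, EdgeInvariant (glueEdges n S) φ ∧
      ∀ c, ∀ x ∈ sgVertices n, φ (sgShift n c x) = ψ c x := by
  obtain ⟨φ, hφ⟩ := exists_glued_labelling ψ hψ
  exact ⟨φ, edgeInvariant_glueEdges.2 fun c => (hinv c).congr (hS c) (hφ c), hφ⟩

lemma compatible_of_invariant (hπ : ∀ c, HasPattern n (π c) (S c)) {φ : ℕ × ℕ → Bool}
    (hφ : EdgeInvariant (glueEdges n S) φ) :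
    CornerPattern.Compatible π fun c d => φ (sgShift n c (sgCorner n d)) :=
  ⟨fun c d => congrArg φ (sgShift_corner_comm n c d),
    fun c => (hπ c).respects (edgeInvariant_glueEdges.1 hφ c)⟩

lemma exists_invariant_of_compatible (hS : ∀ c, S c ⊆ sgEdges n)
    (hπ : ∀ c, HasPattern n (π c) (S c)) {m : Fin 3 → Fin 3 → Bool}
    (hm : CornerPattern.Compatible π m) :
    ∃ φ, EdgeInvariant (glueEdges n S) φ ∧ ∀ c d, φ (sgShift n c (sgCorner n d)) = m c d := by
  choose ψ hψ hψm using fun c => (hπ c).exists_extension (hm.2 c)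
  obtain ⟨φ, hφ, h⟩ := exists_invariant_of_glued hS ψ
    (fun c d => by rw [hψm, hψm, hm.1]) hψ
  exact ⟨φ, hφ, fun c d => by rw [h c _ (sgCorner_mem n d), hψm]⟩

/-- Invariant labellings of the glued set restrict to compatible corner labellings, and every
compatible one arises in this way. So connectivity of the outer corners depends only on the three
patterns. -/
lemma hasPattern_glueEdges (hS : ∀ c, S c ⊆ sgEdges n) (hπ : ∀ c, HasPattern n (π c) (S c))
    (π' : CornerPattern) :
    HasPattern (n + 1) π' (glueEdges n S) ↔ CornerPattern.Induces π π' := by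
  refine forall₂_congr fun i j => iff_congr Iff.rfl ?_
  simp only [sgCorner_succ]
  constructor
  · intro h m hm
    obtain ⟨φ, hφ, hφm⟩ := exists_invariant_of_compatible hS hπ hm
    rw [← hφm, ← hφm, h φ hφ]
  · exact fun h φ hφ => h _ (compatible_of_invariant hπ hφ)

lemma reachesCorners_glueEdges (hS : ∀ c, S c ⊆ sgEdges n)
    (hπ : ∀ c, HasPattern n (π c) (S c)) :
    ReachesCorners (n + 1) (glueEdges n S) ↔
      (∀ c, ReachesCorners n (S c)) ∧ CornerPattern.Spans π := by
  constructor
  · refine fun h => ⟨fun c ψ hψ h0 x hx => ?_, fun m hm h0 c d => ?_⟩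
    -- A labelling of one copy that vanishes at its corners extends by `false` to the other two
    -- copies, so a component missing the corners of its copy also misses the outer corners.
    · obtain ⟨φ, hφ, hφψ⟩ := exists_invariant_of_glued hS
        (Function.update (fun _ _ => false) c ψ)
        (fun a b => by
          have : ∀ a b, Function.update (fun _ _ => false) c ψ a (sgCorner n b) = false := by
            intro a b
            by_cases hac : a = c
            · subst hac
              simp [h0]
            · simp [Function.update_of_ne hac]
          rw [this, this])
        (fun a => by
          by_cases hac : a = c
          · subst hac
            simpa using hψ
          · rw [Function.update_of_ne hac]
            exact fun _ _ _ => rfl)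
      have hv := hφψ c x hx
      rw [Function.update_self] at hv
      rw [← hv]
      refine h φ hφ (fun i => ?_) _ (mem_sgVertices_succ.2 ⟨c, x, hx, rfl⟩)
      rw [sgCorner_succ, hφψ i _ (sgCorner_mem n i)]
      by_cases hic : i = c
      · subst hic
        simp [h0]
      · simp [Function.update_of_ne hic]
    · obtain ⟨φ, hφ, hφm⟩ := exists_invariant_of_compatible hS hπ hm
      rw [← hφm]
      refine h φ hφ (fun i => ?_) _ (mem_sgVertices_succ.2 ⟨c, _, sgCorner_mem n d, rfl⟩)
      rw [sgCorner_succ, hφm, h0]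
  · rintro ⟨h, hs⟩ φ hφ h0 y hy
    obtain ⟨c, x, hx, rfl⟩ := mem_sgVertices_succ.1 hy
    have := hs _ (compatible_of_invariant hπ hφ) fun c => by rw [← sgCorner_succ, h0]
    exact h c _ (edgeInvariant_glueEdges.1 hφ c) (this c) x hx

end Gluing

/-- A spanning subgraph with at most `k` components has at least `|V| - k` edges. -/
lemma card_le_of_reachesCorners {n : ℕ} {π : CornerPattern} {S : Finset (Sym2 (ℕ × ℕ))}
    (h : ReachesCorners n S) (hπ : HasPattern n π S) :
    (sgVertices n).card ≤ S.card + π.blocks := by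
  classical
  obtain ⟨ρ, hρ⟩ := π.exists_representatives
  let ev : ℕ × ℕ → (sgVertices n → ZMod 2) →ₗ[ZMod 2] ZMod 2 := fun x =>
    if hx : x ∈ sgVertices n then LinearMap.proj ⟨x, hx⟩ else 0
  -- The coboundary map, supplemented by evaluation at one corner of each block. The support of a
  -- kernel element is an invariant labelling that vanishes at all corners, hence everywhere;
  -- injectivity bounds the dimension. The orientation chosen by `Quot.out` is immaterial, since
  -- only vanishing of the difference matters.
  let δ : (sgVertices n → ZMod 2) →ₗ[ZMod 2] (S ⊕ Fin π.blocks → ZMod 2) :=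
    LinearMap.pi fun k => Sum.elim
      (fun e => ev (Quot.out e.1).1 - ev (Quot.out e.1).2) (fun k => ev (sgCorner n (ρ k))) k
  have hδ : Function.Injective δ := by
    rw [← LinearMap.ker_eq_bot, LinearMap.ker_eq_bot']
    intro ψ hψ
    have hinv : EdgeInvariant S fun x => decide (ev x ψ ≠ 0) := by
      intro x y hxy
      have h1 : ev (Quot.out s(x, y)).1 ψ - ev (Quot.out s(x, y)).2 ψ = 0 :=
        congrFun hψ (Sum.inl ⟨_, hxy⟩)
      have h2 : s((Quot.out s(x, y)).1, (Quot.out s(x, y)).2) = s(x, y) :=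
        Quot.out_eq s(x, y)
      rcases Sym2.eq_iff.1 h2 with ⟨ha, hb⟩ | ⟨ha, hb⟩ <;> rw [ha, hb, sub_eq_zero] at h1 <;>
        simp [h1]
    have hcorner : ∀ i, decide (ev (sgCorner n i) ψ ≠ 0) = false := by
      intro i
      obtain ⟨k, hk⟩ := hρ i
      have h1 : ev (sgCorner n (ρ k)) ψ = 0 := congrFun hψ (Sum.inr k)
      have := (hπ i (ρ k)).1 hk _ hinv
      rw [this]
      simp [h1]
    funext x
    have := h _ hinv hcorner x.1 x.2
    simpa [ev] using this
  have := LinearMap.finrank_le_finrank_of_injective hδ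
  simpa using this

/-- Forests of `SG(n + 1)` are glued from forests of the three copies of `SG(n)`. -/
theorem isCornerForest_glueEdges {n : ℕ} {S : Fin 3 → Finset (Sym2 (ℕ × ℕ))}
    (hS : ∀ c, S c ⊆ sgEdges n) (π' : CornerPattern) :
    IsCornerForest (n + 1) π' (glueEdges n S) ↔
      ∃ π : Fin 3 → CornerPattern, (∀ c, IsCornerForest n (π c) (S c)) ∧
        CornerPattern.glue (π 0) (π 1) (π 2) = some π' := by
  have hcard := card_sgVertices_succ n
  simp only [← CornerPattern.gluesTo_iff]
  constructor
  · rintro ⟨h1, h2, h3⟩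
    choose π hπ using fun c => exists_hasPattern n (S c)
    obtain ⟨hr, hs⟩ := (reachesCorners_glueEdges hS hπ).1 h1
    have hi := (hasPattern_glueEdges hS hπ π').1 h2
    have hb := CornerPattern.sum_blocks_le hs hi
    -- Adding the three edge bounds to the block bound `hb` gives `3 * |V(n)| ≤ |V(n + 1)| + 3`,
    -- which is an equality. Hence all four bounds are equalities.
    have hle := fun c => card_le_of_reachesCorners (hr c) (hπ c)
    rw [card_glueEdges hS] at h3
    simp only [Fin.sum_univ_three] at h3 hb
    have l0 := hle 0
    have l1 := hle 1
    have l2 := hle 2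
    refine ⟨π, fun c => ⟨hr c, hπ c, ?_⟩, hs, hi, ?_⟩
    · fin_cases c <;> simp only [Fin.zero_eta, Fin.mk_one, Fin.reduceFinMk] <;> omega
    · rw [Fin.sum_univ_three]
      omega
  · rintro ⟨π, hπ, hs, hi, hb⟩
    have hp := fun c => (hπ c).2.1
    refine ⟨(reachesCorners_glueEdges hS hp).2 ⟨fun c => (hπ c).1, hs⟩,
      (hasPattern_glueEdges hS hp π').2 hi, ?_⟩
    have l0 := (hπ 0).2.2
    have l1 := (hπ 1).2.2
    have l2 := (hπ 2).2.2
    rw [card_glueEdges hS]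
    simp only [Fin.sum_univ_three] at hb ⊢
    omega

/-! ### Weighted sums over forests -/

open Classical in
/-- The sum of the weights of the forests of `SG(n)` with pattern `π`. -/
noncomputable def forestSum (n : ℕ) (π : CornerPattern) (w : Finset (Sym2 (ℕ × ℕ)) → ℝ) : ℝ :=
  ∑ S ∈ (sgEdges n).powerset with IsCornerForest n π S, w S

/-- The sum, over the triples of patterns gluing to `q`, of the products of the given values. -/
noncomputable def patternSum (q : CornerPattern) (W : Fin 3 → CornerPattern → ℝ) : ℝ :=
  ∑ π : Fin 3 → CornerPattern,
    if CornerPattern.glue (π 0) (π 1) (π 2) = some q then ∏ c, W c (π c) else 0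

/-- Cutting and gluing are inverse bijections on edge sets, and the pattern of each piece is unique.
For each forest of stage `n + 1` exactly one triple of patterns contributes, so the sum of products
over the table counts it once. -/
theorem forestSum_succ {n : ℕ} (q : CornerPattern) {w : Finset (Sym2 (ℕ × ℕ)) → ℝ}
    {v : Fin 3 → Finset (Sym2 (ℕ × ℕ)) → ℝ}
    (hw : ∀ S : Fin 3 → Finset (Sym2 (ℕ × ℕ)), (∀ c, S c ⊆ sgEdges n) →
      w (glueEdges n S) = ∏ c, v c (S c)) :
    forestSum (n + 1) q w = patternSum q fun c p => forestSum n p (v c) := by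
  classical
  have h1 : forestSum (n + 1) q w =
      ∑ S ∈ Fintype.piFinset fun _ : Fin 3 => (sgEdges n).powerset,
        if IsCornerForest (n + 1) q (glueEdges n S) then ∏ c, v c (S c) else 0 := by
    rw [forestSum, Finset.sum_filter]
    refine Finset.sum_nbij' (cutEdges n) (glueEdges n) ?_ ?_ ?_ ?_ ?_
    · intro S _
      simp [cutEdges_subset]
    · intro S hS
      simp only [Fintype.mem_piFinset, Finset.mem_powerset] at hS
      simpa using glueEdges_subset hS
    · intro S hS
      exact glueEdges_cutEdges (Finset.mem_powerset.1 hS)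
    · intro S hS
      simp only [Fintype.mem_piFinset, Finset.mem_powerset] at hS
      exact cutEdges_glueEdges hS
    · intro S hS
      have hS' := Finset.mem_powerset.1 hS
      rw [← hw _ (cutEdges_subset n S), glueEdges_cutEdges hS']
  have h2 : ∀ π : Fin 3 → CornerPattern, ∏ c, forestSum n (π c) (v c) =
      ∑ S ∈ Fintype.piFinset fun _ : Fin 3 => (sgEdges n).powerset,
        ∏ c, if IsCornerForest n (π c) (S c) then v c (S c) else 0 := by
    intro π
    simp only [forestSum, Finset.sum_filter]
    exact (Finset.sum_prod_piFinset _ fun c S =>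
      if IsCornerForest n (π c) S then v c S else 0).symm
  simp only [patternSum, h1, h2]
  simp only [← Finset.sum_filter, Finset.sum_comm (s := Finset.univ.filter _)]
  rw [Finset.sum_filter]
  refine Finset.sum_congr rfl fun S hS => ?_
  simp only [Fintype.mem_piFinset, Finset.mem_powerset] at hS
  have hiff := isCornerForest_glueEdges hS q
  split_ifs with h
  · obtain ⟨π, hπ, hq⟩ := hiff.1 h
    rw [Finset.sum_eq_single π]
    · exact Finset.prod_congr rfl fun c _ => by rw [if_pos (hπ c)]
    · intro π' _ hne
      obtain ⟨c, hc⟩ := Function.ne_iff.1 hne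
      exact Finset.prod_eq_zero (Finset.mem_univ c)
        (if_neg fun hf => hc (hf.2.1.unique (hπ c).2.1))
    · exact fun hn => (hn (Finset.mem_filter.2 ⟨Finset.mem_univ π, hq⟩)).elim
  · refine (Finset.sum_eq_zero fun π hπ => ?_).symm
    by_contra hne
    refine h (hiff.2 ⟨π, fun c => ?_, (Finset.mem_filter.1 hπ).2⟩)
    by_contra hf
    exact hne (Finset.prod_eq_zero (Finset.mem_univ c) (if_neg hf))

/-! ### Degrees -/

/-- The number of edges in `S` with end `x`. -/
def edgeDegree (S : Finset (Sym2 (ℕ × ℕ))) (x : ℕ × ℕ) : ℕ := (S.filter (x ∈ ·)).card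

/-- The number of edges in the image of `S` in the `c`-th copy with end `y`. -/
def shiftedDegree (n : ℕ) (c : Fin 3) (S : Finset (Sym2 (ℕ × ℕ))) (y : ℕ × ℕ) : ℕ :=
  (S.filter (y ∈ Sym2.map (sgShift n c) ·)).card

lemma edgeDegree_glueEdges {n : ℕ} {S : Fin 3 → Finset (Sym2 (ℕ × ℕ))}
    (hS : ∀ c, S c ⊆ sgEdges n) (y : ℕ × ℕ) :
    edgeDegree (glueEdges n S) y = ∑ c, shiftedDegree n c (S c) y := by
  simp only [edgeDegree, shiftedDegree, Finset.card_filter]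
  exact sum_glueEdges hS _

lemma shiftedDegree_shift (n : ℕ) (c : Fin 3) (S : Finset (Sym2 (ℕ × ℕ))) (x : ℕ × ℕ) :
    shiftedDegree n c S (sgShift n c x) = edgeDegree S x := by
  simp [shiftedDegree, edgeDegree, Sym2.mem_map, (sgShift_injective n c).eq_iff]

lemma shiftedDegree_corner (n : ℕ) (c d : Fin 3) (S : Finset (Sym2 (ℕ × ℕ))) :
    shiftedDegree n d S (sgShift n c (sgCorner n d)) = edgeDegree S (sgCorner n c) := by
  rw [sgShift_corner_comm, shiftedDegree_shift]

lemma shiftedDegree_eq_zero {n : ℕ} {c d : Fin 3} (hdc : d ≠ c) {S : Finset (Sym2 (ℕ × ℕ))}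
    (hS : S ⊆ sgEdges n) {x : ℕ × ℕ} (hx : x ∈ sgVertices n) (hxd : x ≠ sgCorner n d) :
    shiftedDegree n d S (sgShift n c x) = 0 := by
  refine Finset.card_eq_zero.2 (Finset.filter_eq_empty_iff.2 fun e he hxe => hxd ?_)
  obtain ⟨y, hy, hxy⟩ := Sym2.mem_map.1 hxe
  exact (sgShift_overlap hx ((sgEdges_mem_vertices (hS he)).2 y hy) hdc.symm hxy.symm).1

/-- The degree of an interior vertex of a copy. -/
lemma edgeDegree_glueEdges_interior {n : ℕ} {S : Fin 3 → Finset (Sym2 (ℕ × ℕ))}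
    (hS : ∀ c, S c ⊆ sgEdges n) (c : Fin 3) {x : ℕ × ℕ} (hx : x ∈ sgInterior n) :
    edgeDegree (glueEdges n S) (sgShift n c x) = edgeDegree (S c) x := by
  rw [mem_sgInterior] at hx
  rw [edgeDegree_glueEdges hS, Finset.sum_eq_single c]
  · exact shiftedDegree_shift ..
  · exact fun d _ hdc => shiftedDegree_eq_zero hdc (hS d) hx.1 (hx.2 d)
  · simp

/-- The degree of a corner. -/
lemma edgeDegree_glueEdges_corner {n : ℕ} {S : Fin 3 → Finset (Sym2 (ℕ × ℕ))}
    (hS : ∀ c, S c ⊆ sgEdges n) (c : Fin 3) :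
    edgeDegree (glueEdges n S) (sgCorner (n + 1) c) = edgeDegree (S c) (sgCorner n c) := by
  rw [sgCorner_succ, edgeDegree_glueEdges hS, Finset.sum_eq_single c]
  · exact shiftedDegree_shift ..
  · exact fun d _ hdc => shiftedDegree_eq_zero hdc (hS d) (sgCorner_mem n c)
      fun h => hdc (sgCorner_injective n h).symm
  · simp

/-- The degree of the common vertex of two copies. -/
lemma edgeDegree_glueEdges_junction {n : ℕ} {S : Fin 3 → Finset (Sym2 (ℕ × ℕ))}
    (hS : ∀ c, S c ⊆ sgEdges n) {c d : Fin 3} (hcd : c ≠ d) :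
    edgeDegree (glueEdges n S) (sgShift n c (sgCorner n d)) =
      edgeDegree (S c) (sgCorner n d) + edgeDegree (S d) (sgCorner n c) := by
  rw [edgeDegree_glueEdges hS, Fintype.sum_eq_add c d hcd]
  · rw [shiftedDegree_shift, shiftedDegree_corner]
  · exact fun a ha => shiftedDegree_eq_zero ha.1 (hS a) (sgCorner_mem n d)
      fun h => ha.2 (sgCorner_injective n h).symm

lemma glueEdges_sgEdges (n : ℕ) : glueEdges n (fun _ => sgEdges n) = sgEdges (n + 1) :=
  (sgEdges_succ n).symm

lemma edgeDegree_corner_le (n : ℕ) (c : Fin 3) : edgeDegree (sgEdges n) (sgCorner n c) ≤ 2 := by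
  induction n with
  | zero => revert c; decide
  | succ n ih =>
    rw [← glueEdges_sgEdges, edgeDegree_glueEdges_corner fun _ => subset_rfl]
    exact ih

/-- A junction joins two corners of degree at most 2. The bound makes the degree generating
functions polynomials of degree at most 4. -/
lemma edgeDegree_le (n : ℕ) {x : ℕ × ℕ} (hx : x ∈ sgVertices n) :
    edgeDegree (sgEdges n) x ≤ 4 := by
  induction n generalizing x with
  | zero => revert x; decide
  | succ n ih =>
    obtain ⟨c, x, hx', rfl⟩ := mem_sgVertices_succ.1 hx
    rw [← glueEdges_sgEdges]
    by_cases h : ∃ d, x = sgCorner n d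
    · obtain ⟨d, rfl⟩ := h
      by_cases hcd : c = d
      · subst hcd
        rw [← sgCorner_succ, edgeDegree_glueEdges_corner fun _ => subset_rfl]
        exact (edgeDegree_corner_le n c).trans (by norm_num)
      · rw [edgeDegree_glueEdges_junction (fun _ => subset_rfl) hcd]
        have h1 := edgeDegree_corner_le n c
        have h2 := edgeDegree_corner_le n d
        omega
    · push Not at h
      rw [edgeDegree_glueEdges_interior (fun _ => subset_rfl) c (mem_sgInterior.2 ⟨hx', h⟩)]
      exact ih hx'

lemma edgeDegree_mono {S S' : Finset (Sym2 (ℕ × ℕ))} (h : S ⊆ S') (x : ℕ × ℕ) :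
    edgeDegree S x ≤ edgeDegree S' x :=
  Finset.card_le_card (Finset.filter_subset_filter _ h)

/-! ### Recursions -/

/-- The number of forests of `SG(n)` with pattern `p`. -/
noncomputable def forestCount (n : ℕ) (p : CornerPattern) : ℝ := forestSum n p fun _ => 1

/-- The degree generating function at the vertex `x` of the forests with pattern `p`. -/
noncomputable def degreeSum (t : ℝ) (n : ℕ) (x : ℕ × ℕ) (p : CornerPattern) : ℝ :=
  forestSum n p fun S => t ^ edgeDegree S x

/-- The degree generating function at the corner `i` of the forests with pattern `p`. -/
noncomputable def cornerSum (t : ℝ) (n : ℕ) (i : Fin 3) (p : CornerPattern) : ℝ :=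
  degreeSum t n (sgCorner n i) p

/-- The sum over all interior vertices of the degree generating functions of the forests with
pattern `p`. -/
noncomputable def interiorSum (t : ℝ) (n : ℕ) (p : CornerPattern) : ℝ :=
  ∑ x ∈ sgInterior n, degreeSum t n x p

lemma forestCount_succ (n : ℕ) (q : CornerPattern) :
    forestCount (n + 1) q = patternSum q fun _ => forestCount n :=
  forestSum_succ q fun _ _ => by simp

lemma degreeSum_shift (t : ℝ) (n : ℕ) (q : CornerPattern) (c : Fin 3) {x : ℕ × ℕ}
    (hx : x ∈ sgInterior n) :
    degreeSum t (n + 1) (sgShift n c x) q =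
      patternSum q (Function.update (fun _ => forestCount n) c (degreeSum t n x)) := by
  rw [degreeSum, forestSum_succ (v := Function.update (fun _ _ => 1) c
    fun S => t ^ edgeDegree S x)]
  · congr 1
    funext d p
    by_cases hdc : d = c
    · subst hdc
      simp [degreeSum]
    · simp [Function.update_of_ne hdc, forestCount]
  · intro S hS
    rw [edgeDegree_glueEdges_interior hS c hx, Fintype.prod_eq_single c]
    · simp
    · intro d hdc
      simp [Function.update_of_ne hdc]

lemma cornerSum_succ (t : ℝ) (n : ℕ) (q : CornerPattern) (c : Fin 3) :
    cornerSum t (n + 1) c q =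
      patternSum q (Function.update (fun _ => forestCount n) c (cornerSum t n c)) := by
  rw [cornerSum, degreeSum, forestSum_succ (v := Function.update (fun _ _ => 1) c
    fun S => t ^ edgeDegree S (sgCorner n c))]
  · congr 1
    funext d p
    by_cases hdc : d = c
    · subst hdc
      simp [cornerSum, degreeSum]
    · simp [Function.update_of_ne hdc, forestCount]
  · intro S hS
    rw [edgeDegree_glueEdges_corner hS c, Fintype.prod_eq_single c]
    · simp
    · intro d hdc
      simp [Function.update_of_ne hdc]

/-- The degree at a junction is the sum of two corner degrees, so the weight splits into a factor in
each of the two copies; this is the source of the quadratic terms. -/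
lemma degreeSum_junction (t : ℝ) (n : ℕ) (q : CornerPattern) {c d : Fin 3} (hcd : c ≠ d) :
    degreeSum t (n + 1) (sgShift n c (sgCorner n d)) q =
      patternSum q (Function.update (Function.update (fun _ => forestCount n)
        c (cornerSum t n d)) d (cornerSum t n c)) := by
  rw [degreeSum, forestSum_succ (v := Function.update (Function.update (fun _ _ => 1)
    c fun S => t ^ edgeDegree S (sgCorner n d)) d fun S => t ^ edgeDegree S (sgCorner n c))]
  · congr 1
    funext a p
    by_cases had : a = d
    · subst had
      simp [cornerSum, degreeSum]
    · by_cases hac : a = c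
      · subst hac
        simp [Function.update_of_ne had, cornerSum, degreeSum]
      · simp [Function.update_of_ne had, Function.update_of_ne hac, forestCount]
  · intro S hS
    rw [edgeDegree_glueEdges_junction hS hcd, Fintype.prod_eq_mul c d hcd, pow_add]
    · simp [Function.update_of_ne hcd]
    · intro a ha
      simp [Function.update_of_ne ha.1, Function.update_of_ne ha.2]

/-- `patternSum` is linear in each of its three slots. This lets the sum over interior vertices pass
inside, so individual vertices need not be followed. -/
lemma patternSum_update_sum {ι : Type*} (s : Finset ι) (q : CornerPattern)
    (W : Fin 3 → CornerPattern → ℝ) (c : Fin 3) (f : ι → CornerPattern → ℝ) :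
    ∑ x ∈ s, patternSum q (Function.update W c (f x)) =
      patternSum q (Function.update W c fun p => ∑ x ∈ s, f x p) := by
  simp only [patternSum]
  rw [Finset.sum_comm]
  refine Finset.sum_congr rfl fun π _ => ?_
  split_ifs
  · have h : ∀ g : CornerPattern → ℝ, ∏ d, Function.update W c g d (π d) =
        g (π c) * ∏ d ∈ Finset.univ.erase c, W d (π d) := by
      intro g
      rw [← Finset.mul_prod_erase _ _ (Finset.mem_univ c), Function.update_self]
      congr 1
      exact Finset.prod_congr rfl fun d hd => by
        rw [Function.update_of_ne (Finset.ne_of_mem_erase hd)]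
    simp only [h, Finset.sum_mul]
  · simp

lemma interiorSum_succ (t : ℝ) (n : ℕ) (q : CornerPattern) :
    interiorSum t (n + 1) q =
      ∑ c, patternSum q (Function.update (fun _ => forestCount n) c (interiorSum t n)) +
      ∑ c : Fin 3, patternSum q (Function.update (Function.update (fun _ => forestCount n)
        (c + 1) (cornerSum t n (c + 2))) (c + 2) (cornerSum t n (c + 1))) := by
  rw [interiorSum, sum_sgInterior_succ]
  congr 1
  · refine Finset.sum_congr rfl fun c _ => ?_
    rw [show interiorSum t n = fun p => ∑ x ∈ sgInterior n, degreeSum t n x p from rfl,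
      ← patternSum_update_sum]
    exact Finset.sum_congr rfl fun x hx => degreeSum_shift t n q c hx
  · exact Finset.sum_congr rfl fun c _ =>
      degreeSum_junction t n q ((by decide : ∀ c : Fin 3, c + 1 ≠ c + 2) c)

/-! ### Stage zero -/

/-- A decidable form of `HasPattern` at stage zero. -/
def HasPatternZero (π : CornerPattern) (S : Finset (Sym2 (ℕ × ℕ))) : Prop :=
  ∀ i j, π.rel i j = true ↔ ∀ b₀ b₁ b₂ : Bool,
    (s((0, 0), (1, 0)) ∈ S → b₀ = b₁) → (s((0, 0), (0, 1)) ∈ S → b₀ = b₂) →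
      (s((1, 0), (0, 1)) ∈ S → b₁ = b₂) →
      (![b₀, b₁, b₂] : Fin 3 → Bool) i = (![b₀, b₁, b₂] : Fin 3 → Bool) j

instance (π : CornerPattern) (S : Finset (Sym2 (ℕ × ℕ))) : Decidable (HasPatternZero π S) := by
  unfold HasPatternZero; infer_instance

lemma isCornerForest_zero {π : CornerPattern} {S : Finset (Sym2 (ℕ × ℕ))}
    (hS : S ⊆ sgEdges 0) :
    IsCornerForest 0 π S ↔ HasPatternZero π S ∧ S.card + π.blocks = 3 := by
  -- At stage zero every vertex is a corner.
  have hr : ReachesCorners 0 S := by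
    intro φ _ h x hx
    have hx' : ∃ i, x = sgCorner 0 i := by
      revert x; decide
    obtain ⟨i, rfl⟩ := hx'
    exact h i
  have hp : HasPattern 0 π S ↔ HasPatternZero π S := by
    refine forall₂_congr fun i j => iff_congr Iff.rfl ⟨fun h b₀ b₁ b₂ h01 h02 h12 => ?_,
      fun h φ hφ => ?_⟩
    · let φ : ℕ × ℕ → Bool := fun x => if x = (0, 0) then b₀ else if x = (1, 0) then b₁ else b₂
      have hφ : EdgeInvariant S φ := by
        intro x y hxy
        have := hS hxy
        simp only [sgEdges, Finset.mem_insert, Finset.mem_singleton] at this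
        rcases this with he | he | he <;> rw [he] at hxy <;>
          rcases Sym2.eq_iff.1 he with ⟨rfl, rfl⟩ | ⟨rfl, rfl⟩ <;>
          simp [φ, h01, h02, h12, hxy]
      have hi : ∀ i, φ (sgCorner 0 i) = (![b₀, b₁, b₂] : Fin 3 → Bool) i := by
        intro i
        fin_cases i <;> simp [φ, sgCorner]
      rw [← hi, ← hi]
      exact h φ hφ
    · have hi : ∀ i, φ (sgCorner 0 i) =
          (![φ (0, 0), φ (1, 0), φ (0, 1)] : Fin 3 → Bool) i := by
        intro i
        fin_cases i <;> simp [sgCorner]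
      rw [hi, hi]
      exact h _ _ _ (hφ _ _) (hφ _ _) (hφ _ _)
  rw [IsCornerForest, hp]
  exact ⟨fun h => ⟨h.2.1, h.2.2⟩, fun h => ⟨hr, h.1, h.2⟩⟩

lemma forestSum_zero (π : CornerPattern) (w : Finset (Sym2 (ℕ × ℕ)) → ℝ) :
    forestSum 0 π w =
      ∑ S ∈ (sgEdges 0).powerset with (HasPatternZero π S ∧ S.card + π.blocks = 3), w S := by
  classical
  rw [forestSum, Finset.filter_congr fun S hS => isCornerForest_zero (Finset.mem_powerset.1 hS)]

lemma forestSum_zero_joined (w : Finset (Sym2 (ℕ × ℕ)) → ℝ) :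
    forestSum 0 .joined w = w {s((0, 0), (1, 0)), s((0, 0), (0, 1))} +
      w {s((0, 0), (1, 0)), s((1, 0), (0, 1))} + w {s((0, 0), (0, 1)), s((1, 0), (0, 1))} := by
  have h : (sgEdges 0).powerset.filter (fun S => HasPatternZero .joined S ∧
      S.card + CornerPattern.joined.blocks = 3) =
      {{s((0, 0), (1, 0)), s((0, 0), (0, 1))}, {s((0, 0), (1, 0)), s((1, 0), (0, 1))},
        {s((0, 0), (0, 1)), s((1, 0), (0, 1))}} := by decide +kernel
  rw [forestSum_zero, h, Finset.sum_insert (by decide), Finset.sum_insert (by decide),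
    Finset.sum_singleton, add_assoc]

lemma forestSum_zero_isolated (i : Fin 3) (w : Finset (Sym2 (ℕ × ℕ)) → ℝ) :
    forestSum 0 (.isolated i) w = w {s(sgCorner 0 (i + 1), sgCorner 0 (i + 2))} := by
  have h : ∀ i : Fin 3, (sgEdges 0).powerset.filter (fun S => HasPatternZero (.isolated i) S ∧
      S.card + (CornerPattern.isolated i).blocks = 3) =
      {{s(sgCorner 0 (i + 1), sgCorner 0 (i + 2))}} := by decide +kernel
  rw [forestSum_zero, h, Finset.sum_singleton]

lemma forestSum_zero_separated (w : Finset (Sym2 (ℕ × ℕ)) → ℝ) :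
    forestSum 0 .separated w = w ∅ := by
  have h : (sgEdges 0).powerset.filter (fun S => HasPatternZero .separated S ∧
      S.card + CornerPattern.separated.blocks = 3) = {∅} := by decide +kernel
  rw [forestSum_zero, h, Finset.sum_singleton]

/-! ### Explicit recursions -/

lemma patternSum_eq (q : CornerPattern) (W : Fin 3 → CornerPattern → ℝ) :
    patternSum q W = ∑ p : CornerPattern × CornerPattern × CornerPattern with
      CornerPattern.glue p.1 p.2.1 p.2.2 = some q, W 0 p.1 * W 1 p.2.1 * W 2 p.2.2 := by
  let e : (Fin 3 → CornerPattern) ≃ CornerPattern × CornerPattern × CornerPattern :=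
    { toFun := fun π => (π 0, π 1, π 2)
      invFun := fun p => ![p.1, p.2.1, p.2.2]
      left_inv := fun π => by funext i; fin_cases i <;> rfl
      right_inv := fun _ => rfl }
  rw [Finset.sum_filter, patternSum]
  simp only [Fin.prod_univ_three]
  exact Fintype.sum_equiv e _ _ fun _ => rfl

lemma patternSum_eq_list {q : CornerPattern}
    {l : List (CornerPattern × CornerPattern × CornerPattern)} (hl : l.Nodup)
    (h : Finset.univ.filter (fun p : CornerPattern × CornerPattern × CornerPattern =>
      CornerPattern.glue p.1 p.2.1 p.2.2 = some q) = l.toFinset)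
    (W : Fin 3 → CornerPattern → ℝ) :
    patternSum q W = (l.map fun p => W 0 p.1 * W 1 p.2.1 * W 2 p.2.2).sum := by
  rw [patternSum_eq, h, List.sum_toFinset _ hl]

lemma patternSum_joined (W : Fin 3 → CornerPattern → ℝ) :
    patternSum .joined W =
      W 0 .joined * W 1 .joined * W 2 (.isolated 0) +
      W 0 .joined * W 1 .joined * W 2 (.isolated 1) +
      W 0 .joined * W 1 (.isolated 0) * W 2 .joined +
      W 0 .joined * W 1 (.isolated 2) * W 2 .joined +
      W 0 (.isolated 1) * W 1 .joined * W 2 .joined +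
      W 0 (.isolated 2) * W 1 .joined * W 2 .joined := by
  rw [patternSum_eq_list (l := [(.joined, .joined, .isolated 0),
      (.joined, .joined, .isolated 1),
      (.joined, .isolated 0, .joined),
      (.joined, .isolated 2, .joined),
      (.isolated 1, .joined, .joined),
      (.isolated 2, .joined, .joined)])
    (by decide) (by decide +kernel)]
  simp only [List.map_cons, List.map_nil, List.sum_cons, List.sum_nil, add_zero, add_assoc]

lemma patternSum_isolated_zero (W : Fin 3 → CornerPattern → ℝ) :
    patternSum (.isolated 0) W =
      W 0 .joined * W 1 (.isolated 0) * W 2 (.isolated 0) +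
      W 0 (.isolated 0) * W 1 .joined * W 2 (.isolated 0) +
      W 0 (.isolated 0) * W 1 .joined * W 2 (.isolated 1) +
      W 0 (.isolated 0) * W 1 (.isolated 0) * W 2 .joined +
      W 0 (.isolated 0) * W 1 (.isolated 2) * W 2 .joined +
      W 0 (.isolated 1) * W 1 .joined * W 2 (.isolated 0) +
      W 0 (.isolated 2) * W 1 (.isolated 0) * W 2 .joined +
      W 0 .separated * W 1 .joined * W 2 .joined := by
  rw [patternSum_eq_list (l := [(.joined, .isolated 0, .isolated 0),
      (.isolated 0, .joined, .isolated 0),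
      (.isolated 0, .joined, .isolated 1),
      (.isolated 0, .isolated 0, .joined),
      (.isolated 0, .isolated 2, .joined),
      (.isolated 1, .joined, .isolated 0),
      (.isolated 2, .isolated 0, .joined),
      (.separated, .joined, .joined)])
    (by decide) (by decide +kernel)]
  simp only [List.map_cons, List.map_nil, List.sum_cons, List.sum_nil, add_zero, add_assoc]

lemma patternSum_isolated_one (W : Fin 3 → CornerPattern → ℝ) :
    patternSum (.isolated 1) W =
      W 0 .joined * W 1 (.isolated 0) * W 2 (.isolated 1) +
      W 0 .joined * W 1 (.isolated 1) * W 2 (.isolated 0) +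
      W 0 .joined * W 1 (.isolated 1) * W 2 (.isolated 1) +
      W 0 .joined * W 1 .separated * W 2 .joined +
      W 0 (.isolated 1) * W 1 .joined * W 2 (.isolated 1) +
      W 0 (.isolated 1) * W 1 (.isolated 1) * W 2 .joined +
      W 0 (.isolated 1) * W 1 (.isolated 2) * W 2 .joined +
      W 0 (.isolated 2) * W 1 (.isolated 1) * W 2 .joined := by
  rw [patternSum_eq_list (l := [(.joined, .isolated 0, .isolated 1),
      (.joined, .isolated 1, .isolated 0),
      (.joined, .isolated 1, .isolated 1),
      (.joined, .separated, .joined),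
      (.isolated 1, .joined, .isolated 1),
      (.isolated 1, .isolated 1, .joined),
      (.isolated 1, .isolated 2, .joined),
      (.isolated 2, .isolated 1, .joined)])
    (by decide) (by decide +kernel)]
  simp only [List.map_cons, List.map_nil, List.sum_cons, List.sum_nil, add_zero, add_assoc]

lemma patternSum_isolated_two (W : Fin 3 → CornerPattern → ℝ) :
    patternSum (.isolated 2) W =
      W 0 .joined * W 1 .joined * W 2 .separated +
      W 0 .joined * W 1 (.isolated 0) * W 2 (.isolated 2) +
      W 0 .joined * W 1 (.isolated 2) * W 2 (.isolated 0) +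
      W 0 .joined * W 1 (.isolated 2) * W 2 (.isolated 2) +
      W 0 (.isolated 1) * W 1 .joined * W 2 (.isolated 2) +
      W 0 (.isolated 2) * W 1 .joined * W 2 (.isolated 1) +
      W 0 (.isolated 2) * W 1 .joined * W 2 (.isolated 2) +
      W 0 (.isolated 2) * W 1 (.isolated 2) * W 2 .joined := by
  rw [patternSum_eq_list (l := [(.joined, .joined, .separated),
      (.joined, .isolated 0, .isolated 2),
      (.joined, .isolated 2, .isolated 0),
      (.joined, .isolated 2, .isolated 2),
      (.isolated 1, .joined, .isolated 2),
      (.isolated 2, .joined, .isolated 1),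
      (.isolated 2, .joined, .isolated 2),
      (.isolated 2, .isolated 2, .joined)])
    (by decide) (by decide +kernel)]
  simp only [List.map_cons, List.map_nil, List.sum_cons, List.sum_nil, add_zero, add_assoc]

lemma patternSum_separated (W : Fin 3 → CornerPattern → ℝ) :
    patternSum .separated W =
      W 0 .joined * W 1 (.isolated 0) * W 2 .separated +
      W 0 .joined * W 1 (.isolated 1) * W 2 .separated +
      W 0 .joined * W 1 .separated * W 2 (.isolated 0) +
      W 0 .joined * W 1 .separated * W 2 (.isolated 2) +
      W 0 (.isolated 0) * W 1 .joined * W 2 .separated +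
      W 0 (.isolated 0) * W 1 (.isolated 0) * W 2 (.isolated 1) +
      W 0 (.isolated 0) * W 1 (.isolated 0) * W 2 (.isolated 2) +
      W 0 (.isolated 0) * W 1 (.isolated 1) * W 2 (.isolated 0) +
      W 0 (.isolated 0) * W 1 (.isolated 1) * W 2 (.isolated 1) +
      W 0 (.isolated 0) * W 1 (.isolated 2) * W 2 (.isolated 0) +
      W 0 (.isolated 0) * W 1 (.isolated 2) * W 2 (.isolated 2) +
      W 0 (.isolated 0) * W 1 .separated * W 2 .joined +
      W 0 (.isolated 1) * W 1 .joined * W 2 .separated +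
      W 0 (.isolated 1) * W 1 (.isolated 1) * W 2 (.isolated 0) +
      W 0 (.isolated 1) * W 1 (.isolated 1) * W 2 (.isolated 2) +
      W 0 (.isolated 1) * W 1 (.isolated 2) * W 2 (.isolated 0) +
      W 0 (.isolated 1) * W 1 (.isolated 2) * W 2 (.isolated 2) +
      W 0 (.isolated 2) * W 1 (.isolated 0) * W 2 (.isolated 1) +
      W 0 (.isolated 2) * W 1 (.isolated 0) * W 2 (.isolated 2) +
      W 0 (.isolated 2) * W 1 (.isolated 1) * W 2 (.isolated 1) +
      W 0 (.isolated 2) * W 1 (.isolated 1) * W 2 (.isolated 2) +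
      W 0 (.isolated 2) * W 1 .separated * W 2 .joined +
      W 0 .separated * W 1 .joined * W 2 (.isolated 1) +
      W 0 .separated * W 1 .joined * W 2 (.isolated 2) +
      W 0 .separated * W 1 (.isolated 1) * W 2 .joined +
      W 0 .separated * W 1 (.isolated 2) * W 2 .joined := by
  rw [patternSum_eq_list (l := [(.joined, .isolated 0, .separated),
      (.joined, .isolated 1, .separated),
      (.joined, .separated, .isolated 0),
      (.joined, .separated, .isolated 2),
      (.isolated 0, .joined, .separated),
      (.isolated 0, .isolated 0, .isolated 1),
      (.isolated 0, .isolated 0, .isolated 2),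
      (.isolated 0, .isolated 1, .isolated 0),
      (.isolated 0, .isolated 1, .isolated 1),
      (.isolated 0, .isolated 2, .isolated 0),
      (.isolated 0, .isolated 2, .isolated 2),
      (.isolated 0, .separated, .joined),
      (.isolated 1, .joined, .separated),
      (.isolated 1, .isolated 1, .isolated 0),
      (.isolated 1, .isolated 1, .isolated 2),
      (.isolated 1, .isolated 2, .isolated 0),
      (.isolated 1, .isolated 2, .isolated 2),
      (.isolated 2, .isolated 0, .isolated 1),
      (.isolated 2, .isolated 0, .isolated 2),
      (.isolated 2, .isolated 1, .isolated 1),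
      (.isolated 2, .isolated 1, .isolated 2),
      (.isolated 2, .separated, .joined),
      (.separated, .joined, .isolated 1),
      (.separated, .joined, .isolated 2),
      (.separated, .isolated 1, .joined),
      (.separated, .isolated 2, .joined)])
    (by decide) (by decide +kernel)]
  simp only [List.map_cons, List.map_nil, List.sum_cons, List.sum_nil, add_zero, add_assoc]

/-! ### Numbers of forests -/

/-- The ratio of the numbers of forests with patterns `isolated i` and `joined`. -/
noncomputable def forestRatio (n : ℕ) : ℝ := (5 / 3) ^ n / 3

/-- The number of spanning trees. -/
noncomputable def treeCount (n : ℕ) : ℝ := forestCount n .joined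

lemma forestRatio_succ (n : ℕ) : forestRatio (n + 1) = 5 / 3 * forestRatio n := by
  rw [forestRatio, forestRatio, pow_succ]
  ring

lemma forestRatio_pos (n : ℕ) : 0 < forestRatio n := by
  unfold forestRatio
  positivity

/-- With counts in the ratio `1 : r : 3 * r ^ 2`, the gluing table yields `6 * r`, `10 * r ^ 2` and
`50 * r ^ 3` times the cube of the tree count. These are again in such a ratio, with `5 / 3 * r` in
place of `r`. -/
lemma forestCount_eq (n : ℕ) :
    (∀ i, forestCount n (.isolated i) = forestRatio n * treeCount n) ∧
      forestCount n .separated = 3 * forestRatio n ^ 2 * treeCount n := by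
  induction n with
  | zero =>
    simp only [treeCount, forestCount, forestSum_zero_joined, forestSum_zero_isolated,
      forestSum_zero_separated, forestRatio]
    norm_num
  | succ n ih =>
    obtain ⟨h1, h2⟩ := ih
    have hf : forestCount n .joined = treeCount n := rfl
    rw [forestRatio_succ, treeCount]
    refine ⟨fun i => ?_, ?_⟩
    · fin_cases i <;> simp only [Fin.zero_eta, Fin.mk_one, Fin.reduceFinMk] <;>
        simp only [forestCount_succ, patternSum_joined, patternSum_isolated_zero,
          patternSum_isolated_one, patternSum_isolated_two, h1, h2, hf] <;> ring
    · simp only [forestCount_succ, patternSum_joined, patternSum_separated, h1, h2, hf]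
      ring

lemma treeCount_succ (n : ℕ) :
    treeCount (n + 1) = 6 * forestRatio n * treeCount n ^ 3 := by
  obtain ⟨h1, -⟩ := forestCount_eq n
  have hf : forestCount n .joined = treeCount n := rfl
  simp only [treeCount, forestCount_succ, patternSum_joined, h1]
  rw [hf]
  ring

lemma treeCount_pos (n : ℕ) : 0 < treeCount n := by
  induction n with
  | zero =>
    simp only [treeCount, forestCount, forestSum_zero_joined]
    norm_num
  | succ n ih =>
    rw [treeCount_succ]
    have := forestRatio_pos n
    positivity

/-! ### Degrees of the corners -/

/-- The mean of `t ^ deg i` over the forests in which the corner `i` is joined to the others. -/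
noncomputable def meanJoined (t : ℝ) (n : ℕ) : ℝ :=
  (11 * t + 3 * t ^ 2) / 14 + 5 * (t ^ 2 - t) / 42 * (1 / 15) ^ n

/-- The mean of `t ^ deg i` over the forests in which a corner different from `i` is isolated. -/
noncomputable def meanPaired (t : ℝ) (n : ℕ) : ℝ :=
  (11 * t + 3 * t ^ 2) / 14 - 3 * (t ^ 2 - t) / 14 * (1 / 15) ^ n

/-- The mean of `t ^ deg i` over the forests in which the corner `i` is isolated. -/
noncomputable def meanIsolated (t : ℝ) (n : ℕ) : ℝ :=
  (11 * t + 3 * t ^ 2) / 14 + 2 * (t ^ 2 - t) / 7 * (1 / 15) ^ n +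
    (33 - 24 * t - 9 * t ^ 2) / 28 * (3 / 5) ^ n - 5 * (1 - t) ^ 2 / 28 * (1 / 25) ^ n

/-- The mean of `t ^ deg i` over the forests in which all corners are separated. -/
noncomputable def meanSeparated (t : ℝ) (n : ℕ) : ℝ :=
  (11 * t + 3 * t ^ 2) / 14 - 3 * (t ^ 2 - t) / 14 * (1 / 15) ^ n +
    (11 - 8 * t - 3 * t ^ 2) / 14 * (3 / 5) ^ n + 3 * (1 - t) ^ 2 / 14 * (1 / 25) ^ n

/-- In these four recursions the denominators 6, 10 and 50 are the total weights in the gluing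
table. The joined and paired means form a closed system with eigenvalues `1` and `1 / 15`; the
isolated and separated means add `3 / 5` and `1 / 25`. -/
lemma meanJoined_succ (t : ℝ) (n : ℕ) :
    meanJoined t (n + 1) = (4 * meanJoined t n + 2 * meanPaired t n) / 6 := by
  simp only [meanJoined, meanPaired, pow_succ]
  ring

lemma meanPaired_succ (t : ℝ) (n : ℕ) :
    meanPaired t (n + 1) = (6 * meanJoined t n + 4 * meanPaired t n) / 10 := by
  simp only [meanJoined, meanPaired, pow_succ]
  ring

lemma meanIsolated_succ (t : ℝ) (n : ℕ) :
    meanIsolated t (n + 1) = (meanJoined t n + 4 * meanIsolated t n + 2 * meanPaired t n +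
      3 * meanSeparated t n) / 10 := by
  simp only [meanJoined, meanPaired, meanIsolated, meanSeparated, pow_succ]
  ring

lemma meanSeparated_succ (t : ℝ) (n : ℕ) :
    meanSeparated t (n + 1) = (12 * meanJoined t n + 12 * meanIsolated t n +
      14 * meanPaired t n + 12 * meanSeparated t n) / 50 := by
  simp only [meanJoined, meanPaired, meanIsolated, meanSeparated, pow_succ]
  ring

/-- The generating functions of the corner degrees, in terms of their means. -/
structure CornerSumsEq (t : ℝ) (n : ℕ) : Prop where
  joined : ∀ i, cornerSum t n i .joined = treeCount n * meanJoined t n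
  isolated : ∀ i, cornerSum t n i (.isolated i) =
    forestRatio n * treeCount n * meanIsolated t n
  paired : ∀ i j, i ≠ j → cornerSum t n i (.isolated j) =
    forestRatio n * treeCount n * meanPaired t n
  separated : ∀ i, cornerSum t n i .separated =
    3 * forestRatio n ^ 2 * treeCount n * meanSeparated t n

lemma cornerSumsEq_zero (t : ℝ) : CornerSumsEq t 0 := by
  have ht : treeCount 0 = 3 := by
    simp only [treeCount, forestCount, forestSum_zero_joined]
    norm_num
  have hr : forestRatio 0 = 1 / 3 := by simp [forestRatio]
  have d1 : ∀ i : Fin 3, edgeDegree {s(sgCorner 0 (i + 1), sgCorner 0 (i + 2))}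
      (sgCorner 0 i) = 0 := by decide
  have d2 : ∀ i j : Fin 3, i ≠ j → edgeDegree {s(sgCorner 0 (j + 1), sgCorner 0 (j + 2))}
      (sgCorner 0 i) = 1 := by decide
  constructor
  · intro i
    simp only [cornerSum, degreeSum, forestSum_zero_joined, ht, meanJoined]
    -- Each corner has degree 2 in exactly one of the three spanning trees of a triangle.
    have h := (by decide : ∀ i : Fin 3,
      (edgeDegree {s((0, 0), (1, 0)), s((0, 0), (0, 1))} (sgCorner 0 i),
        edgeDegree {s((0, 0), (1, 0)), s((1, 0), (0, 1))} (sgCorner 0 i),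
        edgeDegree {s((0, 0), (0, 1)), s((1, 0), (0, 1))} (sgCorner 0 i)) ∈
        ({(2, 1, 1), (1, 2, 1), (1, 1, 2)} : Finset (ℕ × ℕ × ℕ))) i
    simp only [Finset.mem_insert, Finset.mem_singleton, Prod.mk.injEq] at h
    rcases h with ⟨h1, h2, h3⟩ | ⟨h1, h2, h3⟩ | ⟨h1, h2, h3⟩ <;> rw [h1, h2, h3] <;> ring
  · intro i
    simp only [cornerSum, degreeSum, forestSum_zero_isolated, ht, hr, meanIsolated, d1]
    ring
  · intro i j hij
    simp only [cornerSum, degreeSum, forestSum_zero_isolated, ht, hr, meanPaired, d2 i j hij]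
    ring
  · intro i
    simp only [cornerSum, degreeSum, forestSum_zero_separated, ht, hr, meanSeparated, edgeDegree]
    simp
    ring

lemma cornerSumsEq (t : ℝ) (n : ℕ) : CornerSumsEq t n := by
  induction n with
  | zero => exact cornerSumsEq_zero t
  | succ n ih =>
    obtain ⟨hJ, hI, hP, hS⟩ := ih
    obtain ⟨h1, h2⟩ := forestCount_eq n
    have hf : forestCount n .joined = treeCount n := rfl
    have p01 := hP 0 1 (by decide)
    have p02 := hP 0 2 (by decide)
    have p10 := hP 1 0 (by decide)
    have p12 := hP 1 2 (by decide)
    have p20 := hP 2 0 (by decide)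
    have p21 := hP 2 1 (by decide)
    constructor
    · intro i
      rw [cornerSum_succ, treeCount_succ, meanJoined_succ]
      fin_cases i <;> simp [patternSum_joined] <;>
        simp only [*] <;> ring
    · intro i
      rw [cornerSum_succ, treeCount_succ, forestRatio_succ, meanIsolated_succ]
      fin_cases i <;> simp [patternSum_isolated_zero, patternSum_isolated_one,
        patternSum_isolated_two] <;>
        simp only [*] <;> ring
    · intro i j hij
      rw [cornerSum_succ, treeCount_succ, forestRatio_succ, meanPaired_succ]
      fin_cases i <;> fin_cases j <;> simp at hij <;> simp [patternSum_isolated_zero,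
        patternSum_isolated_one, patternSum_isolated_two] <;>
        simp only [*] <;> ring
    · intro i
      rw [cornerSum_succ, treeCount_succ, forestRatio_succ, meanSeparated_succ]
      fin_cases i <;> simp [patternSum_separated] <;>
        simp only [*] <;> ring

/-! ### Degrees of the interior vertices -/

/-- The contribution of the three vertices joining two copies to the mean over trees. -/
noncomputable def junctionJoined (t : ℝ) (n : ℕ) : ℝ :=
  meanJoined t n * (meanJoined t n + meanPaired t n + meanIsolated t n)

/-- The contribution of the three vertices joining two copies to the mean over the forests with
an isolated corner. -/
noncomputable def junctionIsolated (t : ℝ) (n : ℕ) : ℝ :=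
  (3 * meanJoined t n ^ 2 + 8 * meanJoined t n * meanPaired t n +
    6 * meanJoined t n * meanIsolated t n + 6 * meanJoined t n * meanSeparated t n +
    4 * meanIsolated t n * meanPaired t n + 3 * meanPaired t n ^ 2) / 10

/-- The contribution of the three vertices joining two copies to the mean over the forests with
separated corners. -/
noncomputable def junctionSeparated (t : ℝ) (n : ℕ) : ℝ :=
  (18 * meanPaired t n * meanSeparated t n + 18 * meanJoined t n * meanSeparated t n +
    9 * meanJoined t n * meanIsolated t n + 9 * meanJoined t n * meanPaired t n +
    12 * meanIsolated t n * meanPaired t n + 9 * meanPaired t n ^ 2) / 25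

/-- The sums over the interior vertices `x` of the means of `t ^ deg x`, over the trees, over the
forests with one isolated corner, and over those with separated corners. -/
noncomputable def interiorMeans (t : ℝ) : ℕ → ℝ × ℝ × ℝ
  | 0 => (0, 0, 0)
  | n + 1 =>
    (2 * (interiorMeans t n).1 + (interiorMeans t n).2.1 + junctionJoined t n,
      (13 * (interiorMeans t n).1 + 14 * (interiorMeans t n).2.1 +
        3 * (interiorMeans t n).2.2) / 10 + junctionIsolated t n,
      (36 * (interiorMeans t n).1 + 78 * (interiorMeans t n).2.1 +
        36 * (interiorMeans t n).2.2) / 50 + junctionSeparated t n)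

/-- The interior degree generating functions, in terms of the means. -/
structure InteriorSumsEq (t : ℝ) (n : ℕ) : Prop where
  joined : interiorSum t n .joined = treeCount n * (interiorMeans t n).1
  isolated : ∀ i, interiorSum t n (.isolated i) =
    forestRatio n * treeCount n * (interiorMeans t n).2.1
  separated : interiorSum t n .separated =
    3 * forestRatio n ^ 2 * treeCount n * (interiorMeans t n).2.2

/-- The terms with one weighted slot give the linear part of the recursion for `interiorMeans`; the
terms with two weighted slots give the junction contributions. -/
lemma interiorSumsEq (t : ℝ) (n : ℕ) : InteriorSumsEq t n := by
  induction n with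
  | zero => constructor <;> simp [interiorSum, sgInterior_zero, interiorMeans]
  | succ n ih =>
    obtain ⟨hJ, hI, hS⟩ := ih
    obtain ⟨cJ, cI, cP, cS⟩ := cornerSumsEq t n
    obtain ⟨h1, h2⟩ := forestCount_eq n
    have hf : forestCount n .joined = treeCount n := rfl
    have p01 := cP 0 1 (by decide)
    have p02 := cP 0 2 (by decide)
    have p10 := cP 1 0 (by decide)
    have p12 := cP 1 2 (by decide)
    have p20 := cP 2 0 (by decide)
    have p21 := cP 2 1 (by decide)
    have e1 : (1 : Fin 3) + 1 = 2 := rfl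
    have e2 : (1 : Fin 3) + 2 = 0 := rfl
    have e3 : (2 : Fin 3) + 1 = 0 := rfl
    have e4 : (2 : Fin 3) + 2 = 1 := rfl
    constructor
    · rw [interiorSum_succ, treeCount_succ, interiorMeans, junctionJoined]
      simp [patternSum_joined, Function.update_apply, Fin.sum_univ_three, e1, e2, e3, e4]
      simp only [*]
      ring
    · intro i
      rw [interiorSum_succ, treeCount_succ, forestRatio_succ, interiorMeans, junctionIsolated]
      fin_cases i <;> simp [patternSum_isolated_zero, patternSum_isolated_one,
        patternSum_isolated_two, Function.update_apply, Fin.sum_univ_three, e1, e2, e3, e4] <;>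
        simp only [*] <;> ring
    · rw [interiorSum_succ, treeCount_succ, forestRatio_succ, interiorMeans, junctionSeparated]
      simp [patternSum_separated, Function.update_apply, Fin.sum_univ_three, e1, e2, e3, e4]
      simp only [*]
      ring

/-! ### Asymptotics -/

/-- The limit of the average of `t ^ deg x`. -/
noncomputable def limitMean (t : ℝ) : ℝ :=
  10957 / 40464 * t + 6626035 / 13636368 * t ^ 2 + 2943139 / 13636368 * t ^ 3 +
    124895 / 4545456 * t ^ 4

/-- The combination of the interior means belonging to the leading eigenvalue of the recursion. -/
lemma interiorMeans_leading (t : ℝ) (n : ℕ) :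
    (53 * (interiorMeans t n).1 + 38 * (interiorMeans t n).2.1 +
      5 * (interiorMeans t n).2.2) / 96 = 3 / 2 * limitMean t * 3 ^ n -
      ((363 * t ^ 2 + 198 * t ^ 3 + 27 * t ^ 4) / 392 +
      (-33 * t ^ 2 + 24 * t ^ 3 + 9 * t ^ 4) / 392 * (1 / 15) ^ n +
      (275 * t ^ 2 - 550 * t ^ 3 + 275 * t ^ 4) / 198156 * (1 / 225) ^ n +
      (363 * t - 165 * t ^ 2 - 171 * t ^ 3 - 27 * t ^ 4) / 784 * (3 / 5) ^ n +
      (-275 * t + 475 * t ^ 2 - 125 * t ^ 3 - 75 * t ^ 4) / 4704 * (1 / 25) ^ n +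
      (1075 * t - 3225 * t ^ 2 + 3225 * t ^ 3 - 1075 * t ^ 4) / 660912 * (1 / 375) ^ n) := by
  induction n with
  | zero =>
    -- The initial means vanish, which fixes the multiple of `3 ^ n`: `3 / 2 * limitMean t` is the
    -- sum of the coefficients of the correction terms.
    simp only [interiorMeans, limitMean]
    ring
  | succ n ih =>
    -- All rates are monomials in `(1 / 15) ^ n` and `(3 / 5) ^ n`, so that `ring` can compare
    -- products of means with the closed form.
    have e1 : (1 / 225 : ℝ) ^ n = ((1 / 15) ^ n) ^ 2 := by
      rw [← pow_mul, mul_comm, pow_mul]; norm_num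
    have e2 : (1 / 25 : ℝ) ^ n = (1 / 15) ^ n * (3 / 5) ^ n := by
      rw [← mul_pow]; norm_num
    have e3 : (1 / 375 : ℝ) ^ n = (1 / 15) ^ n * ((1 / 15) ^ n * (3 / 5) ^ n) := by
      rw [← mul_pow, ← mul_pow]; norm_num
    -- `(53, 38, 5)` is a left eigenvector of the recursion matrix for the eigenvalue 3, scaled by
    -- 96 to have coordinate sum 1.
    have step : (53 * (interiorMeans t (n + 1)).1 + 38 * (interiorMeans t (n + 1)).2.1 +
        5 * (interiorMeans t (n + 1)).2.2) / 96 =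
        3 * ((53 * (interiorMeans t n).1 + 38 * (interiorMeans t n).2.1 +
          5 * (interiorMeans t n).2.2) / 96) +
        (53 * junctionJoined t n + 38 * junctionIsolated t n +
          5 * junctionSeparated t n) / 96 := by
      simp only [interiorMeans]
      ring
    rw [step, ih]
    simp only [junctionJoined, junctionIsolated, junctionSeparated, meanJoined, meanPaired,
      meanIsolated, meanSeparated, limitMean, pow_succ _ n, e1, e2, e3]
    ring

/-- A multiplier of modulus at most 1 and a bounded source allow at most linear growth. -/
lemma tendsto_div_three_pow {x s : ℕ → ℝ} {l C : ℝ} (hl : |l| ≤ 1) (hs : ∀ n, |s n| ≤ C)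
    (hx : ∀ n, x (n + 1) = l * x n + s n) :
    Filter.Tendsto (fun n => x n / 3 ^ n) Filter.atTop (nhds 0) := by
  have hb : ∀ n : ℕ, |x n| ≤ |x 0| + C * n := by
    intro n
    induction n with
    | zero => simp
    | succ n ih =>
      have h1 : |l * x n| ≤ |x n| := by
        rw [abs_mul]
        exact mul_le_of_le_one_left (abs_nonneg _) hl
      have h2 := abs_add_le (l * x n) (s n)
      rw [← hx] at h2
      have h3 := hs n
      push_cast
      linarith
  have h0 : Filter.Tendsto (fun n : ℕ => (|x 0| + C * n) / 3 ^ n) Filter.atTop (nhds 0) := by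
    have h1 := tendsto_pow_const_div_const_pow_of_one_lt 0 (r := (3 : ℝ)) (by norm_num)
    have h2 := tendsto_pow_const_div_const_pow_of_one_lt 1 (r := (3 : ℝ)) (by norm_num)
    have := (h1.const_mul |x 0|).add (h2.const_mul C)
    simp only [mul_zero, add_zero] at this
    refine this.congr fun n => ?_
    ring
  refine squeeze_zero_norm (fun n => ?_) h0
  rw [Real.norm_eq_abs, abs_div, abs_of_pos (by positivity : (0 : ℝ) < 3 ^ n)]
  gcongr
  exact hb n

lemma exists_bound_of_tendsto {s : ℕ → ℝ} {a : ℝ}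
    (h : Filter.Tendsto s Filter.atTop (nhds a)) : ∃ C, ∀ n, |s n| ≤ C := by
  obtain ⟨C, hC⟩ := (Metric.isBounded_range_of_tendsto s h).exists_norm_le
  exact ⟨C, fun n => hC _ ⟨n, rfl⟩⟩

lemma tendsto_interiorMeans (t : ℝ) :
    Filter.Tendsto (fun n => (interiorMeans t n).1 / 3 ^ n) Filter.atTop
      (nhds (3 / 2 * limitMean t)) := by
  have geom : ∀ r : ℝ, 0 ≤ r → r < 1 →
      Filter.Tendsto (fun n : ℕ => r ^ n) Filter.atTop (nhds 0) :=
    fun r => tendsto_pow_atTop_nhds_zero_of_lt_one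
  have g15 := geom (1 / 15) (by norm_num) (by norm_num)
  have g35 := geom (3 / 5) (by norm_num) (by norm_num)
  have g25 := geom (1 / 25) (by norm_num) (by norm_num)
  have g225 := geom (1 / 225) (by norm_num) (by norm_num)
  have g375 := geom (1 / 375) (by norm_num) (by norm_num)
  have g3 := geom (1 / 3) (by norm_num) (by norm_num)
  have hJ : ∃ a, Filter.Tendsto (meanJoined t) Filter.atTop (nhds a) :=
    ⟨_, tendsto_const_nhds.add (g15.const_mul _)⟩
  have hP : ∃ a, Filter.Tendsto (meanPaired t) Filter.atTop (nhds a) :=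
    ⟨_, tendsto_const_nhds.sub (g15.const_mul _)⟩
  have hI : ∃ a, Filter.Tendsto (meanIsolated t) Filter.atTop (nhds a) :=
    ⟨_, ((tendsto_const_nhds.add (g15.const_mul _)).add (g35.const_mul _)).sub
      (g25.const_mul _)⟩
  have hS : ∃ a, Filter.Tendsto (meanSeparated t) Filter.atTop (nhds a) :=
    ⟨_, ((tendsto_const_nhds.sub (g15.const_mul _)).add (g35.const_mul _)).add
      (g25.const_mul _)⟩
  obtain ⟨a, ha⟩ := hJ
  obtain ⟨b, hb⟩ := hP
  obtain ⟨c, hc⟩ := hI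
  obtain ⟨d, hd⟩ := hS
  have jJ : Filter.Tendsto (junctionJoined t) Filter.atTop (nhds _) :=
    ha.mul ((ha.add hb).add hc)
  have jI : Filter.Tendsto (junctionIsolated t) Filter.atTop (nhds _) :=
    (((((((ha.pow 2).const_mul 3).add ((ha.const_mul 8).mul hb)).add
      ((ha.const_mul 6).mul hc)).add ((ha.const_mul 6).mul hd)).add
      ((hc.const_mul 4).mul hb)).add ((hb.pow 2).const_mul 3)).div_const 10
  have jS : Filter.Tendsto (junctionSeparated t) Filter.atTop (nhds _) :=
    ((((((((hb.const_mul 18).mul hd).add ((ha.const_mul 18).mul hd)).add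
      ((ha.const_mul 9).mul hc)).add ((ha.const_mul 9).mul hb)).add
      ((hc.const_mul 12).mul hb))).add ((hb.pow 2).const_mul 9)).div_const 25
  obtain ⟨C, hC⟩ := exists_bound_of_tendsto
    (((jJ.const_mul (-29)).add (jI.const_mul 14)).add (jS.const_mul 15))
  obtain ⟨C', hC'⟩ := exists_bound_of_tendsto ((jJ.sub (jI.const_mul 2)).add jS)
  -- The left eigenvectors `(-29, 14, 15)` and `(1, -2, 1)`, for the eigenvalues `1` and `3 / 25`,
  -- give components negligible against `3 ^ n`.
  have z := tendsto_div_three_pow (x := fun n => -29 * (interiorMeans t n).1 +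
    14 * (interiorMeans t n).2.1 + 15 * (interiorMeans t n).2.2) (l := 1) (by norm_num) hC
    fun n => by
      simp only [interiorMeans]
      ring
  have x := tendsto_div_three_pow (x := fun n => (interiorMeans t n).1 -
    2 * (interiorMeans t n).2.1 + (interiorMeans t n).2.2) (l := 3 / 25)
    (by norm_num [abs_of_pos]) hC'
    fun n => by
      simp only [interiorMeans]
      ring
  have q := ((((((tendsto_const_nhds (x := (363 * t ^ 2 + 198 * t ^ 3 + 27 * t ^ 4) / 392)).add
    (g15.const_mul ((-33 * t ^ 2 + 24 * t ^ 3 + 9 * t ^ 4) / 392))).add (g225.const_mul ((275 * t ^ 2 - 550 * t ^ 3 + 275 * t ^ 4) / 198156))).add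
    (g35.const_mul ((363 * t - 165 * t ^ 2 - 171 * t ^ 3 - 27 * t ^ 4) / 784))).add (g25.const_mul ((-275 * t + 475 * t ^ 2 - 125 * t ^ 3 - 75 * t ^ 4) / 4704))).add (g375.const_mul ((1075 * t - 3225 * t ^ 2 + 3225 * t ^ 3 - 1075 * t ^ 4) / 660912))).mul g3
  -- The coefficients `1`, `-1 / 88` and `125 / 1056` express the first coordinate through the three
  -- left eigenvectors.
  have key := (((tendsto_const_nhds (x := 3 / 2 * limitMean t) (f := Filter.atTop)).sub q).sub
    (z.const_mul (1 / 88))).add (x.const_mul (125 / 1056))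
  simp only [mul_zero, sub_zero, add_zero] at key
  refine key.congr fun n => ?_
  have h := interiorMeans_leading t n
  have h3 : (1 / 3 : ℝ) ^ n = 1 / 3 ^ n := by rw [one_div_pow]
  have h3' : (3 : ℝ) ^ n ≠ 0 := by positivity
  have h4 : (3 : ℝ) ^ n * (1 / 3 ^ n) = 1 := mul_one_div_cancel h3'
  rw [h3]
  linear_combination (-(1 / 3 ^ n)) * h - 3 / 2 * limitMean t * h4

/-! ### Spanning trees as edge sets -/

/-- The graph on the vertices of `SG(n)` with the edges `S`. -/
def graphOfEdges (n : ℕ) (S : Finset (Sym2 (ℕ × ℕ))) : SimpleGraph (sgVertices n) where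
  Adj x y := x ≠ y ∧ s((x : ℕ × ℕ), (y : ℕ × ℕ)) ∈ S
  symm := ⟨fun x y h => ⟨h.1.symm, by rw [Sym2.eq_swap]; exact h.2⟩⟩
  loopless := ⟨fun _ h => h.1 rfl⟩

section

variable {n : ℕ} {S : Finset (Sym2 (ℕ × ℕ))}

lemma graphOfEdges_adj (hS : S ⊆ sgEdges n) {x y : sgVertices n} :
    (graphOfEdges n S).Adj x y ↔ s((x : ℕ × ℕ), (y : ℕ × ℕ)) ∈ S := by
  refine ⟨And.right, fun h => ⟨?_, h⟩⟩
  rintro rfl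
  exact (sgEdges_mem_vertices (hS h)).1 (by simp)

lemma exists_graphOfEdges {T : SimpleGraph (sgVertices n)} (hT : T ≤ SG n) :
    ∃ S ⊆ sgEdges n, graphOfEdges n S = T := by
  classical
  refine ⟨(sgEdges n).filter fun e => ∃ x y, T.Adj x y ∧ s((x : ℕ × ℕ), (y : ℕ × ℕ)) = e,
    Finset.filter_subset _ _, ?_⟩
  ext x y
  rw [graphOfEdges_adj (Finset.filter_subset _ _), Finset.mem_filter]
  constructor
  · rintro ⟨-, a, b, hab, h⟩
    rcases Sym2.eq_iff.1 h with ⟨h1, h2⟩ | ⟨h1, h2⟩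
    · rwa [← Subtype.ext h1, ← Subtype.ext h2]
    · rw [← Subtype.ext h1, ← Subtype.ext h2]
      exact hab.symm
  · exact fun h => ⟨(hT h).2, x, y, h, rfl⟩

lemma graphOfEdges_le (hS : S ⊆ sgEdges n) : graphOfEdges n S ≤ SG n :=
  fun _ _ h => ⟨h.1, hS h.2⟩

lemma image_edgeSet_graphOfEdges (hS : S ⊆ sgEdges n) :
    Sym2.map Subtype.val '' (graphOfEdges n S).edgeSet = S := by
  ext e
  constructor
  · rintro ⟨e, he, rfl⟩
    induction e using Sym2.ind with
    | _ x y => exact (graphOfEdges_adj hS).1 he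
  · intro he
    induction e using Sym2.ind with
    | _ x y =>
      have hv := (sgEdges_mem_vertices (hS he)).2
      exact ⟨s(⟨x, hv x (by simp)⟩, ⟨y, hv y (by simp)⟩), (graphOfEdges_adj hS).2 he, rfl⟩

lemma graphOfEdges_injOn : Set.InjOn (graphOfEdges n) {S | S ⊆ sgEdges n} := by
  intro S hS S' hS' h
  rw [← Finset.coe_inj, ← image_edgeSet_graphOfEdges hS, ← image_edgeSet_graphOfEdges hS', h]

lemma card_edgeSet_graphOfEdges (hS : S ⊆ sgEdges n) :
    Nat.card (graphOfEdges n S).edgeSet = S.card := by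
  have h := congrArg Set.ncard (image_edgeSet_graphOfEdges hS)
  rw [Set.ncard_image_of_injective _ (Sym2.map.injective Subtype.val_injective),
    Set.ncard_coe_finset] at h
  exact h

open Classical in
lemma degree_graphOfEdges (hS : S ⊆ sgEdges n) (x : sgVertices n) :
    (graphOfEdges n S).degree x = edgeDegree S x := by
  rw [← SimpleGraph.card_neighborFinset_eq_degree, edgeDegree]
  refine Finset.card_bij (fun y _ => s((x : ℕ × ℕ), (y : ℕ × ℕ))) ?_ ?_ ?_
  · intro y hy
    rw [SimpleGraph.mem_neighborFinset, graphOfEdges_adj hS] at hy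
    simp [hy]
  · intro y _ z _ h
    exact Subtype.ext (Sym2.congr_right.1 h)
  · intro e he
    obtain ⟨he, hx⟩ := Finset.mem_filter.1 he
    obtain ⟨y, rfl⟩ := Sym2.mem_iff_exists.1 hx
    have hv := (sgEdges_mem_vertices (hS he)).2
    refine ⟨⟨y, hv y (by simp)⟩, ?_, rfl⟩
    rw [SimpleGraph.mem_neighborFinset, graphOfEdges_adj hS]
    exact he

lemma EdgeInvariant.eq_of_reachable {φ : ℕ × ℕ → Bool} (hφ : EdgeInvariant S φ)
    {x y : sgVertices n} (h : (graphOfEdges n S).Reachable x y) : φ x = φ y := by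
  obtain ⟨p⟩ := h
  induction p with
  | nil => rfl
  | cons h _ ih => exact (hφ _ _ h.2).trans ih

-- For the converse, the set of vertices not reachable from corner 0 has an invariant indicator. It
-- vanishes at corner 0, hence at all corners by the pattern, hence everywhere.
open Classical in
lemma connected_graphOfEdges_iff (hS : S ⊆ sgEdges n) :
    (graphOfEdges n S).Connected ↔ ReachesCorners n S ∧ HasPattern n .joined S := by
  constructor
  · intro h
    have hc : ∀ φ, EdgeInvariant S φ → ∀ x ∈ sgVertices n, ∀ y ∈ sgVertices n, φ x = φ y :=
      fun φ hφ x hx y hy => hφ.eq_of_reachable (h.preconnected ⟨x, hx⟩ ⟨y, hy⟩)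
    refine ⟨fun φ hφ h0 x hx => ?_, fun i j => ⟨fun _ φ hφ => ?_, fun _ => rfl⟩⟩
    · rw [hc φ hφ x hx _ (sgCorner_mem n 0), h0]
    · exact hc φ hφ _ (sgCorner_mem n i) _ (sgCorner_mem n j)
  · rintro ⟨hr, hp⟩
    let o : sgVertices n := ⟨sgCorner n 0, sgCorner_mem n 0⟩
    let φ : ℕ × ℕ → Bool := fun x => decide (∃ hx, ¬ (graphOfEdges n S).Reachable o ⟨x, hx⟩)
    have hφ : EdgeInvariant S φ := by
      intro x y hxy
      have hv := (sgEdges_mem_vertices (hS hxy)).2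
      have hx := hv x (by simp)
      have hy := hv y (by simp)
      have hadj : (graphOfEdges n S).Adj ⟨x, hx⟩ ⟨y, hy⟩ := (graphOfEdges_adj hS).2 hxy
      refine decide_eq_decide.2 ⟨?_, ?_⟩
      · rintro ⟨_, h⟩
        exact ⟨hy, fun h' => h (h'.trans hadj.symm.reachable)⟩
      · rintro ⟨_, h⟩
        exact ⟨hx, fun h' => h (h'.trans hadj.reachable)⟩
    have h0 : φ (sgCorner n 0) = false := by
      refine decide_eq_false ?_
      rintro ⟨_, h⟩
      exact h (SimpleGraph.Reachable.refl _)
    have hall := hr φ hφ fun i => by rw [(hp i 0).1 rfl φ hφ, h0]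
    have hreach : ∀ x : sgVertices n, (graphOfEdges n S).Reachable o x := by
      intro x
      by_contra h
      exact of_decide_eq_false (hall x x.2) ⟨x.2, h⟩
    have : Nonempty (sgVertices n) := ⟨o⟩
    exact ⟨fun x y => (hreach x).symm.trans (hreach y)⟩

/-- A connected graph is a tree iff it has one edge fewer than vertices, and `joined` has one block.
-/
lemma isTree_graphOfEdges_iff (hS : S ⊆ sgEdges n) :
    (graphOfEdges n S).IsTree ↔ IsCornerForest n .joined S := by
  rw [SimpleGraph.isTree_iff_connected_and_card, connected_graphOfEdges_iff hS,
    card_edgeSet_graphOfEdges hS, IsCornerForest, and_assoc, Nat.card_eq_fintype_card,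
    Fintype.card_coe]
  rfl

end

/-! ### Degree distribution of spanning trees -/

open Classical in
lemma ncard_spanningTrees_filter (n : ℕ) (P : Finset (Sym2 (ℕ × ℕ)) → Prop)
    (Q : SimpleGraph (sgVertices n) → Prop)
    (hPQ : ∀ S ⊆ sgEdges n, (Q (graphOfEdges n S) ↔ P S)) :
    ({T ∈ spanningTrees (SG n) | Q T}.ncard : ℝ) =
      forestSum n .joined fun S => if P S then 1 else 0 := by
  have h : {T ∈ spanningTrees (SG n) | Q T} = graphOfEdges n ''
      (((sgEdges n).powerset.filter fun S => IsCornerForest n .joined S).filter fun S => P S :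
        Finset (Finset (Sym2 (ℕ × ℕ)))) := by
    ext T
    simp only [spanningTrees, Set.mem_ofPred_eq, Set.mem_image, Finset.mem_coe, Finset.mem_filter,
      Finset.mem_powerset]
    constructor
    · rintro ⟨⟨hT, hT'⟩, hQ⟩
      obtain ⟨S, hS, rfl⟩ := exists_graphOfEdges hT
      exact ⟨S, ⟨⟨hS, (isTree_graphOfEdges_iff hS).1 hT'⟩, (hPQ S hS).1 hQ⟩, rfl⟩
    · rintro ⟨S, ⟨⟨hS, hT⟩, hP⟩, rfl⟩
      exact ⟨⟨graphOfEdges_le hS, (isTree_graphOfEdges_iff hS).2 hT⟩, (hPQ S hS).2 hP⟩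
  rw [h, Set.InjOn.ncard_image, Set.ncard_coe_finset, forestSum, ← Finset.sum_filter,
    Finset.sum_const, nsmul_eq_mul, mul_one]
  refine graphOfEdges_injOn.mono fun S hS => ?_
  simp only [Finset.mem_coe, Finset.mem_filter, Finset.mem_powerset] at hS
  exact hS.1.1

lemma ncard_spanningTrees (n : ℕ) : ((spanningTrees (SG n)).ncard : ℝ) = treeCount n := by
  have := ncard_spanningTrees_filter n (fun _ => True) (fun _ => True) fun _ _ => Iff.rfl
  simpa [treeCount, forestCount] using this

lemma sum_degreeProb (t : ℝ) (n : ℕ) (x : sgVertices n) :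
    ∑ j ∈ Finset.range 5, t ^ j * degreeProb j n x =
      degreeSum t n x .joined / treeCount n := by
  classical
  have h : ∀ j, degreeProb j n x =
      (forestSum n .joined fun S => if edgeDegree S x = j then 1 else 0) / treeCount n := by
    intro j
    rw [degreeProb, ncard_spanningTrees, ncard_spanningTrees_filter n
      (fun S => edgeDegree S x = j) _ fun S hS => by rw [← degree_graphOfEdges hS]]
    congr!
  simp only [h, ← mul_div_assoc, ← Finset.sum_div]
  congr 1
  simp only [forestSum, degreeSum, Finset.mul_sum]
  rw [Finset.sum_comm]
  refine Finset.sum_congr rfl fun S hS => ?_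
  have hS' := Finset.mem_powerset.1 (Finset.mem_filter.1 hS).1
  -- Since the degree is below 5, exactly one index `j` in the range picks up the tree.
  have hd : edgeDegree S x < 5 :=
    Nat.lt_succ_of_le ((edgeDegree_mono hS' x).trans (edgeDegree_le n x.2))
  simp [hd]

lemma sum_averageDegreeProb (t : ℝ) (n : ℕ) :
    ∑ j ∈ Finset.range 5, t ^ j * averageDegreeProb j n =
      ((interiorMeans t n).1 + 3 * meanJoined t n) / (3 / 2 * (3 ^ n + 1)) := by
  have hc : ((sgVertices n).card : ℝ) = 3 / 2 * (3 ^ n + 1) := by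
    have : (2 : ℝ) * (sgVertices n).card = 3 * (3 ^ n + 1) := by
      exact_mod_cast two_mul_card_sgVertices n
    linarith
  have ht := (treeCount_pos n).ne'
  simp only [averageDegreeProb, hc, ← mul_div_assoc, ← Finset.sum_div, Finset.mul_sum]
  rw [Finset.sum_comm]
  simp only [sum_degreeProb]
  congr 1
  rw [Finset.sum_coe_sort (sgVertices n) fun x => degreeSum t n x .joined / treeCount n,
    ← Finset.sum_div, sum_sgVertices]
  have h1 : ∑ x ∈ sgInterior n, degreeSum t n x .joined =
      treeCount n * (interiorMeans t n).1 := (interiorSumsEq t n).joined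
  have h2 : ∀ i, degreeSum t n (sgCorner n i) .joined = treeCount n * meanJoined t n :=
    (cornerSumsEq t n).joined
  simp only [h1, h2, Finset.sum_const, Finset.card_univ, Fintype.card_fin]
  field_simp
  ring

lemma tendsto_sum_averageDegreeProb (t : ℝ) :
    Filter.Tendsto (fun n => ∑ j ∈ Finset.range 5, t ^ j * averageDegreeProb j n) Filter.atTop
      (nhds (limitMean t)) := by
  have g3 : Filter.Tendsto (fun n : ℕ => (1 / 3 : ℝ) ^ n) Filter.atTop (nhds 0) :=
    tendsto_pow_atTop_nhds_zero_of_lt_one (by norm_num) (by norm_num)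
  have g15 : Filter.Tendsto (fun n : ℕ => (1 / 15 : ℝ) ^ n) Filter.atTop (nhds 0) :=
    tendsto_pow_atTop_nhds_zero_of_lt_one (by norm_num) (by norm_num)
  have hm : Filter.Tendsto (meanJoined t) Filter.atTop (nhds _) :=
    tendsto_const_nhds.add (g15.const_mul _)
  -- Numerator and denominator are divided by `3 ^ n`; the three corners contribute nothing in the
  -- limit.
  have key := ((tendsto_interiorMeans t).add ((hm.const_mul 3).mul g3)).div
    ((g3.const_add 1).const_mul (3 / 2)) (by norm_num)
  have hlim : ∀ a : ℝ, (3 / 2 * limitMean t + 3 * a * 0) / (3 / 2 * (1 + 0)) = limitMean t := by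
    intro a
    ring
  rw [hlim] at key
  refine key.congr fun n => ?_
  simp only [Pi.div_apply, sum_averageDegreeProb, one_div_pow]
  have h3 : (3 : ℝ) ^ n ≠ 0 := by positivity
  field_simp

theorem mainTheorem1 :
    Filter.Tendsto (fun n : ℕ => averageDegreeProb 1 n) Filter.atTop
        (nhds (10957 / 40464 : ℝ)) ∧
      Filter.Tendsto (fun n : ℕ => averageDegreeProb 2 n) Filter.atTop
        (nhds (6626035 / 13636368 : ℝ)) ∧
      Filter.Tendsto (fun n : ℕ => averageDegreeProb 3 n) Filter.atTop
        (nhds (2943139 / 13636368 : ℝ)) ∧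
      Filter.Tendsto (fun n : ℕ => averageDegreeProb 4 n) Filter.atTop
        (nhds (124895 / 4545456 : ℝ)) := by
  have h := tendsto_sum_averageDegreeProb
  -- Interpolation at `0, 1, -1, 2, -2`.
  have comb : ∀ a b c d e : ℝ, Filter.Tendsto (fun n =>
      a * (∑ j ∈ Finset.range 5, (0 : ℝ) ^ j * averageDegreeProb j n) +
      b * (∑ j ∈ Finset.range 5, (1 : ℝ) ^ j * averageDegreeProb j n) +
      c * (∑ j ∈ Finset.range 5, (-1 : ℝ) ^ j * averageDegreeProb j n) +
      d * (∑ j ∈ Finset.range 5, (2 : ℝ) ^ j * averageDegreeProb j n) +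
      e * (∑ j ∈ Finset.range 5, (-2 : ℝ) ^ j * averageDegreeProb j n)) Filter.atTop
      (nhds (a * limitMean 0 + b * limitMean 1 + c * limitMean (-1) + d * limitMean 2 +
        e * limitMean (-2))) := fun a b c d e =>
    (((((h 0).const_mul a).add ((h 1).const_mul b)).add ((h (-1)).const_mul c)).add
      ((h 2).const_mul d)).add ((h (-2)).const_mul e)
  refine ⟨?_, ?_, ?_, ?_⟩
  -- The coefficients in the four cases are rows of the inverse Vandermonde matrix for these nodes:
  -- each combination isolates one coefficient of a polynomial of degree at most 4, both in the sums
  -- and in `limitMean`.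
  · convert comb 0 (2 / 3) (-2 / 3) (-1 / 12) (1 / 12) using 2
    · simp only [Finset.sum_range_succ, Finset.sum_range_zero]
      ring
    · simp only [limitMean]
      norm_num
  · convert comb (-5 / 4) (2 / 3) (2 / 3) (-1 / 24) (-1 / 24) using 2
    · simp only [Finset.sum_range_succ, Finset.sum_range_zero]
      ring
    · simp only [limitMean]
      norm_num
  · convert comb 0 (-1 / 6) (1 / 6) (1 / 12) (-1 / 12) using 2
    · simp only [Finset.sum_range_succ, Finset.sum_range_zero]
      ring
    · simp only [limitMean]
      norm_num
  · convert comb (1 / 4) (-1 / 6) (-1 / 6) (1 / 24) (1 / 24) using 2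
    · simp only [Finset.sum_range_succ, Finset.sum_range_zero]
      ring
    · simp only [limitMean]
      norm_num
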